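/- Let $M$ be a smooth manifold of dimension $n=p+q\ge 3$ with a conformal structure of signature $(p,q)$, and let $\pi:\mathcal Q\to M$ be its ray bundle, whose fibre over $x$ consists of the values $g_x$ of the metrics $g$ in the conformal class, with the action $\rho^s(g_x)=s^2g_x$ of $\mathbb R_+$. Let $\tilde M$ be an ambient manifold: a smooth $(n+2)$-manifold with a free smooth $\mathbb R_+$-action $\rho$ and an $\mathbb R_+$-equivariant embedding $\mathcal Q\hookrightarrow\tilde M$. Let $\mathbf h$ be an ambient metric on $\tilde M$: a smooth pseudo-Riemannian metric of signature $(p+1,q+1)$ with $(\rho^s)^*\mathbf h=s^2\mathbf h$ for all $s>0$, and with $\mathbf h(\xi,\eta)=g_x(T\pi\,\xi,T\pi\,\eta)$ for $u=g_x\in\mathcal Q$ and $\xi,\eta\in T_u\mathcal Q$. Let $\tilde\nabla$ be the Levi-Civita connection of $\mathbf h$, $\tilde\Delta=\mathbf h^{EF}\tilde\nabla_E\tilde\nabla_F$ its Laplacian, $\tilde R_{AB}{}^C{}_D$ its curvature, with the convention $[\tilde\nabla_A,\tilde\nabla_B]V^C=\tilde R_{AB}{}^C{}_DV^D$, and $\mathrm{Ric}_{AB}=\tilde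 R_{CA}{}^C{}_B$; indices are raised and lowered with $\mathbf h$ (in particular $\tilde R_{ABCD}=\mathbf h_{CE}\tilde R_{AB}{}^E{}_D$), and $[BC]$ denotes antisymmetrization with the factor $\tfrac12$. Then: (1) $\tilde\nabla^E\tilde R_{EABC}=2\tilde\nabla_{[B}\mathrm{Ric}_{C]A}$. (2) $\tilde\Delta\tilde R_{ABCD}=2\bigl(\tilde\nabla_A\tilde\nabla_{[C}\mathrm{Ric}_{D]B}-\tilde\nabla_B\tilde\nabla_{[C}\mathrm{Ric}_{D]A}\bigr)+\Psi_{ABCD}$, where $\Psi_{ABCD}$ is a linear combination of partial contractions of $\tilde R\otimes\tilde R$, with universal real coefficients (independent of $n$, the conformal structure, the ambient manifold and the ambient metric). (3) For every smooth covariant tensor field $\Phi_{A\dots B}$ on $\tilde M$, of any rank, $$\begin{aligned}[\tilde\Delta,\tilde\nabla_C]\Phi_{A\dots B}={}&-2\mathbf h^{EF}\bigl(\Phi_{E\dots B}\tilde\nabla_{[F}\mathrm{Ric}_{A]C}+\dots+\Phi_{A\dots E}\tilde\nabla_{[F}\mathrm{Ric}_{B]C}\bigr)\\&-2\bigl(\tilde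 R_{EC}{}^F{}_A\tilde\nabla^E\Phi_{F\dots B}+\dots+\tilde R_{EC}{}^F{}_B\tilde\nabla^E\Phi_{A\dots F}\bigr)\\&+\mathrm{Ric}_{CE}\tilde\nabla^E\Phi_{A\dots B},\end{aligned}$$ where each of the two sums in parentheses has one summand for each index of $\Phi$. -/

import Mathlib

open scoped Manifold ContDiff

noncomputable section

/-! ## Tensor calculus in a coordinate patch

Everything in this section lives on the coordinate space `ℝ^m`. A covariant tensor field of rank `k`
is given by its component functions, the matrix `g` consists of the components `g_{ij}` of a
pseudo-Riemannian metric. -/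

namespace LocalTensor

/-- The coordinate space `ℝ^m`. -/
abbrev Coord (m : ℕ) : Type := EuclideanSpace ℝ (Fin m)

/-- Component functions `T_{i₁ … i_k}` of a covariant tensor field of rank `k`. -/
abbrev Comp (m k : ℕ) : Type := Coord m → (Fin k → Fin m) → ℝ

variable {m k : ℕ}

/-- The partial derivative `∂_i f`. -/
def pd (i : Fin m) (f : Coord m → ℝ) (y : Coord m) : ℝ :=
  fderiv ℝ f y (EuclideanSpace.single i 1)

/-- The components `g^{ij}` of the inverse metric. -/
def up (g : Coord m → Matrix (Fin m) (Fin m) ℝ) (y : Coord m) (i j : Fin m) : ℝ :=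
  (g y)⁻¹ i j

/-- The Christoffel symbols `Γ^c_{ab}` of the Levi-Civita connection of `g`. -/
def christoffel (g : Coord m → Matrix (Fin m) (Fin m) ℝ) (y : Coord m) (c a b : Fin m) : ℝ :=
  (1 / 2) * ∑ d, up g y c d *
    (pd a (fun z => g z b d) y + pd b (fun z => g z a d) y - pd d (fun z => g z a b) y)

/-- The covariant derivative `∇_{i₀} T_{i₁ … i_k}`; the index of the derivative comes first. -/
def cov (g : Coord m → Matrix (Fin m) (Fin m) ℝ) (T : Comp m k) : Comp m (k + 1) :=
  fun y I => pd (I 0) (fun z => T z (Fin.tail I)) y -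
    ∑ r : Fin k, ∑ l, christoffel g y l (I 0) (Fin.tail I r) *
      T y (Function.update (Fin.tail I) r l)

/-- The Laplacian `Δ T = g^{ef} ∇_e ∇_f T`. -/
def laplacian (g : Coord m → Matrix (Fin m) (Fin m) ℝ) (T : Comp m k) : Comp m k :=
  fun y I => ∑ e, ∑ f, up g y e f * cov g (cov g T) y (Fin.cons e (Fin.cons f I))

/-- The curvature `R_{ab}{}^c{}_d`, with the convention `[∇_a, ∇_b] V^c = R_{ab}{}^c{}_d V^d`. -/
def curv (g : Coord m → Matrix (Fin m) (Fin m) ℝ) (y : Coord m) (a b c d : Fin m) : ℝ :=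
  pd a (fun z => christoffel g z c b d) y - pd b (fun z => christoffel g z c a d) y +
    ∑ l, (christoffel g y c a l * christoffel g y l b d -
      christoffel g y c b l * christoffel g y l a d)

/-- The curvature with all indices lowered, `R_{abcd} = g_{ce} R_{ab}{}^e{}_d`. -/
def riem (g : Coord m → Matrix (Fin m) (Fin m) ℝ) : Comp m 4 :=
  fun y I => ∑ e, g y (I 2) e * curv g y (I 0) (I 1) e (I 3)

/-- The Ricci curvature `Ric_{ab} = R_{ca}{}^c{}_b`. -/
def ric (g : Coord m → Matrix (Fin m) (Fin m) ℝ) : Comp m 2 :=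
  fun y I => ∑ c, curv g y c (I 0) c (I 1)

/-- The tensor `∇_{[b} Ric_{c]a}`, as a tensor with indices in the order `b, c, a`. -/
def skewCovRic (g : Coord m → Matrix (Fin m) (Fin m) ℝ) : Comp m 3 :=
  fun y I => (1 / 2) * (cov g (ric g) y ![I 0, I 1, I 2] - cov g (ric g) y ![I 1, I 0, I 2])

/-- The partial contraction of `R ⊗ R` with four free indices given by a permutation `σ` of the
eight index slots: label the slots by `a, b, c, d, e, f, s, t` in the order described by `σ`,
and contract with `g^{ef} g^{st}`; the free indices are `a, b, c, d`. -/
def contractRR (g : Coord m → Matrix (Fin m) (Fin m) ℝ) (σ : Equiv.Perm (Fin (4 + 4))) :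
    Comp m 4 :=
  fun y I => ∑ J : Fin 4 → Fin m, up g y (J 0) (J 1) * up g y (J 2) (J 3) *
    (riem g y (fun r => (Fin.append I J : Fin (4 + 4) → Fin m) (σ (Fin.castAdd 4 r))) *
      riem g y (fun r => (Fin.append I J : Fin (4 + 4) → Fin m) (σ (Fin.natAdd 4 r))))

end LocalTensor

/-! ## Tensor fields and metrics on a manifold -/

/-- The bilinear form `B` has signature `(p, q)`: it is `diag(1, …, 1, -1, …, -1)`, with `p` entries
`1` and `q` entries `-1`, in some basis. In particular `B` is symmetric and nondegenerate. -/
def HasSignature {V : Type*} [AddCommGroup V] [Module ℝ V] (p q : ℕ)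
    (B : LinearMap.BilinForm ℝ V) : Prop :=
  ∃ b : Module.Basis (Fin p ⊕ Fin q) ℝ V,
    ∀ i j, B (b i) (b j) =
      Matrix.diagonal (Sum.elim (fun _ => (1 : ℝ)) (fun _ => (-1 : ℝ))) i j

section Manifold

variable {m : ℕ} {N : Type*} [TopologicalSpace N] [ChartedSpace (EuclideanSpace ℝ (Fin m)) N]

/-- The coordinate vector field `∂_i` of the chart `e`, at the point with coordinates `y`. -/
def coordVec (e : OpenPartialHomeomorph N (EuclideanSpace ℝ (Fin m)))
    (y : EuclideanSpace ℝ (Fin m)) (i : Fin m) : TangentSpace (𝓡 m) (e.symm y) :=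
  mfderiv (𝓡 m) (𝓡 m) e.symm y (EuclideanSpace.single i (1 : ℝ) : EuclideanSpace ℝ (Fin m))

/-- Covariant tensor fields of rank `k` (without smoothness). -/
abbrev CovTensorField (m k : ℕ) (N : Type*) [TopologicalSpace N]
    [ChartedSpace (EuclideanSpace ℝ (Fin m)) N] : Type _ :=
  ∀ x : N, MultilinearMap ℝ (fun _ : Fin k => TangentSpace (𝓡 m) x) ℝ

/-- The components of a covariant tensor field in the chart `e`. -/
def CovTensorField.comp {k : ℕ} (Φ : CovTensorField m k N)
    (e : OpenPartialHomeomorph N (EuclideanSpace ℝ (Fin m))) : LocalTensor.Comp m k :=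
  fun y I => Φ (e.symm y) (fun r => coordVec e y (I r))

/-- A covariant tensor field is smooth if its components in every smooth chart are smooth. -/
def CovTensorField.IsSmooth {k : ℕ} (Φ : CovTensorField m k N) : Prop :=
  ∀ e ∈ IsManifold.maximalAtlas (𝓡 m) ∞ N, ∀ I : Fin k → Fin m,
    ContDiffOn ℝ ∞ (fun y => Φ.comp e y I) e.target

/-- The components of a field of bilinear forms in the chart `e`. -/
def bilinComp (h : ∀ x : N, LinearMap.BilinForm ℝ (TangentSpace (𝓡 m) x))
    (e : OpenPartialHomeomorph N (EuclideanSpace ℝ (Fin m)))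
    (y : EuclideanSpace ℝ (Fin m)) : Matrix (Fin m) (Fin m) ℝ :=
  Matrix.of fun i j => h (e.symm y) (coordVec e y i) (coordVec e y j)

/-- Smooth pseudo-Riemannian metrics of signature `(p, q)` on the `m`-dimensional manifold `N`. -/
structure PseudoRiemannianMetric (m p q : ℕ) (N : Type*) [TopologicalSpace N]
    [ChartedSpace (EuclideanSpace ℝ (Fin m)) N] where
  form : ∀ x : N, LinearMap.BilinForm ℝ (TangentSpace (𝓡 m) x)
  signature : ∀ x, HasSignature p q (form x)
  smooth : ∀ e ∈ IsManifold.maximalAtlas (𝓡 m) ∞ N, ∀ i j,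
    ContDiffOn ℝ ∞ (fun y => bilinComp form e y i j) e.target

end Manifold

/-! ## Conformal structures and ambient metrics -/

section Conformal

variable {n p q : ℕ} {M : Type*} [TopologicalSpace M] [ChartedSpace (EuclideanSpace ℝ (Fin n)) M]

/-- Two metrics are conformally equivalent if they differ by a positive smooth function. -/
instance conformalSetoid (n p q : ℕ) (M : Type*) [TopologicalSpace M]
    [ChartedSpace (EuclideanSpace ℝ (Fin n)) M] : Setoid (PseudoRiemannianMetric n p q M) where
  r g g' := ∃ f : M → ℝ, ContMDiff (𝓡 n) 𝓘(ℝ, ℝ) ∞ f ∧ (∀ x, 0 < f x) ∧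
    ∀ x, g'.form x = f x • g.form x
  iseqv :=
    { refl := fun g => ⟨fun _ => 1, contMDiff_const, fun _ => one_pos, fun x => (one_smul _ _).symm⟩
      symm := by
        rintro g g' ⟨f, hf, hpos, h⟩
        refine ⟨fun x => (f x)⁻¹, ?_, fun x => inv_pos.2 (hpos x), fun x => ?_⟩
        · exact hf.inv₀ fun x => (hpos x).ne'
        · rw [h x, smul_smul, inv_mul_cancel₀ (hpos x).ne', one_smul]
      trans := by
        rintro g g' g'' ⟨f, hf, hpos, h⟩ ⟨f', hf', hpos', h'⟩
        refine ⟨fun x => f' x * f x, hf'.mul hf, fun x => mul_pos (hpos' x) (hpos x), fun x => ?_⟩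
        rw [h' x, h x, smul_smul] }

/-- A conformal structure of signature `(p, q)` on the `n`-dimensional manifold `M`. -/
def ConformalStructure (n p q : ℕ) (M : Type*) [TopologicalSpace M]
    [ChartedSpace (EuclideanSpace ℝ (Fin n)) M] : Type _ :=
  Quotient (conformalSetoid n p q M)

theorem smul_smul_bilin {V : Type*} [AddCommGroup V] [Module ℝ V] {B C : LinearMap.BilinForm ℝ V}
    (s t : ℝ) (h : B = t • C) : s • B = (s * t) • C := by
  rw [h, smul_smul]

namespace ConformalStructure

/-- The metric `g` belongs to the conformal class `c`. -/
def Contains (c : ConformalStructure n p q M) (g : PseudoRiemannianMetric n p q M) : Prop :=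
  Quotient.mk (conformalSetoid n p q M) g = c

/-- The ray bundle `Q → M` of the conformal structure: its points are the pairs `(x, s • g_x)`
where `g` is a metric in the conformal class and `s > 0`. -/
def RayBundle (c : ConformalStructure n p q M) : Type _ :=
  { u : Σ x : M, LinearMap.BilinForm ℝ (TangentSpace (𝓡 n) x) //
    ∃ g : PseudoRiemannianMetric n p q M, c.Contains g ∧ ∃ s : ℝ, 0 < s ∧ u.2 = s • g.form u.1 }

/-- The principal action `ρ^s (g_x) = s² g_x` of the positive reals on `Q`. -/
def scale (c : ConformalStructure n p q M) (s : {s : ℝ // 0 < s}) (u : c.RayBundle) :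
    c.RayBundle :=
  ⟨⟨u.1.1, (s : ℝ) ^ 2 • u.1.2⟩, by
    obtain ⟨⟨x, B⟩, g, hg, t, ht, h⟩ := u
    exact ⟨g, hg, (s : ℝ) ^ 2 * t, mul_pos (pow_pos s.2 2) ht, smul_smul_bilin _ _ h⟩⟩

/-- The global trivialization `M × ℝ → Q`, `(x, t) ↦ e^{2t} g_x`, given by a metric `g` in the
conformal class. The smooth structure of `Q` is the one making these bijections diffeomorphisms. -/
def triv (c : ConformalStructure n p q M) (g : PseudoRiemannianMetric n p q M)
    (hg : c.Contains g) (z : M × ℝ) : c.RayBundle :=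
  ⟨⟨z.1, Real.exp (2 * z.2) • g.form z.1⟩, g, hg, Real.exp (2 * z.2), Real.exp_pos _, rfl⟩

end ConformalStructure

/-- An ambient manifold of the conformal structure `c`, with underlying `(n+2)`-manifold `N`:
a free smooth action of the group of positive reals on `N`, and an equivariant embedding of the ray
bundle `Q` into `N`. -/
structure AmbientManifold (c : ConformalStructure n p q M) (N : Type*) [TopologicalSpace N]
    [ChartedSpace (EuclideanSpace ℝ (Fin (n + 2))) N] where
  act : {s : ℝ // 0 < s} → N → N
  act_one : ∀ u, act 1 u = u
  act_mul : ∀ s t u, act (s * t) u = act s (act t u)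
  /-- Smoothness of the action, in the parameter `t = log s`. -/
  act_smooth : ContMDiff (𝓘(ℝ, ℝ).prod (𝓡 (n + 2))) (𝓡 (n + 2)) ∞
    (fun z : ℝ × N => act ⟨Real.exp z.1, Real.exp_pos z.1⟩ z.2)
  act_free : ∀ s u, act s u = u → s = 1
  /-- The embedding of `Q`. -/
  emb : c.RayBundle → N
  emb_equivariant : ∀ s u, emb (c.scale s u) = act s (emb u)
  /-- `emb` is a smooth embedding, expressed in the trivializations of `Q`. -/
  emb_isSmoothEmbedding : ∀ g (hg : c.Contains g),
    Manifold.IsSmoothEmbedding ((𝓡 n).prod 𝓘(ℝ, ℝ)) (𝓡 (n + 2)) ∞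
      (fun z : M × ℝ => emb (c.triv g hg z))

/-- Ambient metrics: metrics of signature `(p+1, q+1)` on the ambient manifold which are homogeneous
of degree `2` and restrict to the tautological form on `Q`. -/
structure AmbientMetric {c : ConformalStructure n p q M} {N : Type*} [TopologicalSpace N]
    [ChartedSpace (EuclideanSpace ℝ (Fin (n + 2))) N] (A : AmbientManifold c N) extends
    PseudoRiemannianMetric (n + 2) (p + 1) (q + 1) N where
  /-- `(ρ^s)^* h = s² h`. -/
  homogeneous : ∀ (s : {s : ℝ // 0 < s}) (u : N) (ξ η : TangentSpace (𝓡 (n + 2)) u),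
    form (A.act s u) (mfderiv (𝓡 (n + 2)) (𝓡 (n + 2)) (A.act s) u ξ)
      (mfderiv (𝓡 (n + 2)) (𝓡 (n + 2)) (A.act s) u η) = (s : ℝ) ^ 2 * form u ξ η
  /-- `h(ξ, η) = g_x(Tπ ξ, Tπ η)` for `ξ, η` tangent to `Q` at the point `u = g_x`. Here the
  point is written as `u = e^{2t} g_x` in a trivialization, in which `π` is the projection to the
  first factor. -/
  tautological : ∀ g (hg : c.Contains g) (z : M × ℝ)
    (ξ η : TangentSpace ((𝓡 n).prod 𝓘(ℝ, ℝ)) z),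
    form (A.emb (c.triv g hg z))
      (mfderiv ((𝓡 n).prod 𝓘(ℝ, ℝ)) (𝓡 (n + 2)) (fun w : M × ℝ => A.emb (c.triv g hg w)) z ξ)
      (mfderiv ((𝓡 n).prod 𝓘(ℝ, ℝ)) (𝓡 (n + 2)) (fun w : M × ℝ => A.emb (c.triv g hg w)) z η) =
    (c.triv g hg z).1.2
      (mfderiv ((𝓡 n).prod 𝓘(ℝ, ℝ)) (𝓡 n) (Prod.fst : M × ℝ → M) z ξ)
      (mfderiv ((𝓡 n).prod 𝓘(ℝ, ℝ)) (𝓡 n) (Prod.fst : M × ℝ → M) z η)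

/-- The matrix of components of the ambient metric in a chart. -/
def AmbientMetric.comp {c : ConformalStructure n p q M} {N : Type*} [TopologicalSpace N]
    [ChartedSpace (EuclideanSpace ℝ (Fin (n + 2))) N] {A : AmbientManifold c N}
    (h : AmbientMetric A) (e : OpenPartialHomeomorph N (EuclideanSpace ℝ (Fin (n + 2)))) :
    LocalTensor.Coord (n + 2) → Matrix (Fin (n + 2)) (Fin (n + 2)) ℝ :=
  bilinComp h.form e

end Conformal

end

open LocalTensor

noncomputable section

/-! All three identities are local consequences of the symmetries of the Levi-Civita curvature and
of the Ricci identity, so they are proved in one chart. Everything but differentiation is algebra,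
and the calculus is therefore done over a commutative ring with commuting derivations; the ring of
smooth functions on the chart image is substituted at the end.

(1) is the second Bianchi identity `covCurv_cyclic` traced once, after pair symmetry `lower_pair`
has moved the contracted index (`div_riem`).

(2) Bianchi gives `∇_f R_{abcd} = ∇_a R_{fbcd} - ∇_b R_{facd}`. Apply `∇_e` and contract with
`g^{ef}`. Commuting `∇_e` past `∇_a` leaves `∇_a` of a divergence, known from (1), and a curvature
acting on `R`; the latter is the quadratic term `quad` (`lap_riem`). `quad_eq_sum` writes it as four
contractions given by fixed permutations of the eight index slots, so the coefficients are
universal.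

(3) In `∇_e∇_f∇_c Φ` the index `c` is moved to the front by two Ricci identities (`lap_cov_sub`).
The inner one, differentiated, yields `∇R` acting on `Φ`, whose trace is given by (1), and `R`
acting on `∇Φ`; the outer one yields the same `R` term again, hence the factor 2, and a Ricci term
from the slot `f`. -/

/-- A metric with its Levi-Civita connection, over a commutative ring with commuting derivations. -/
structure MetricConnection (A ι : Type*) [CommRing A] [Fintype ι] [DecidableEq ι] where
  D : ι → Derivation ℤ A A
  D_comm : ∀ i j a, D i (D j a) = D j (D i a)
  g : Matrix ι ι A
  u : Matrix ι ι A
  /-- The Christoffel symbols, `Γ a c b = Γ^c_{ab}`. -/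
  Γ : ι → Matrix ι ι A
  g_symm : g.transpose = g
  g_mul_u : g * u = 1
  torsion_free : ∀ a b c, Γ a c b = Γ b c a
  metric : ∀ a, g.map (D a) = (Γ a).transpose * g + g * Γ a

/-! ### Matrix calculus of the connection and the algebraic symmetries of the curvature. -/

namespace MetricConnection

set_option linter.unusedSectionVars false

variable {A ι : Type*} [CommRing A] [Fintype ι] [DecidableEq ι] (S : MetricConnection A ι)

/-- Components of a covariant tensor. -/
abbrev Tens (A ι : Type*) (k : ℕ) : Type _ := (Fin k → ι) → A

variable {k : ℕ}

/-- The entrywise derivative of a matrix. -/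
def dm (a : ι) (X : Matrix ι ι A) : Matrix ι ι A := X.map (S.D a)

theorem dm_apply (a : ι) (X : Matrix ι ι A) (i j : ι) : S.dm a X i j = S.D a (X i j) := rfl

theorem dm_mul (a : ι) (X Y : Matrix ι ι A) : S.dm a (X * Y) = S.dm a X * Y + X * S.dm a Y := by
  ext i j
  simp only [dm_apply, Matrix.mul_apply, Matrix.add_apply, map_sum, Derivation.leibniz,
    smul_eq_mul, ← Finset.sum_add_distrib]
  exact Finset.sum_congr rfl fun l _ => by ring

theorem dm_add (a : ι) (X Y : Matrix ι ι A) : S.dm a (X + Y) = S.dm a X + S.dm a Y := by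
  ext i j; simp [dm_apply]

theorem dm_sub (a : ι) (X Y : Matrix ι ι A) : S.dm a (X - Y) = S.dm a X - S.dm a Y := by
  ext i j; simp [dm_apply]

theorem dm_transpose (a : ι) (X : Matrix ι ι A) : S.dm a X.transpose = (S.dm a X).transpose := rfl

theorem dm_comm (a b : ι) (X : Matrix ι ι A) : S.dm a (S.dm b X) = S.dm b (S.dm a X) := by
  ext i j; simp [dm_apply, S.D_comm a b]

theorem dm_one (a : ι) : S.dm a 1 = 0 := by
  ext i j
  by_cases h : i = j <;> simp [dm_apply, h]

theorem u_mul_g : S.u * S.g = 1 := mul_eq_one_comm.1 S.g_mul_u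

theorem dm_g (a : ι) : S.dm a S.g = (S.Γ a).transpose * S.g + S.g * S.Γ a := S.metric a

theorem dm_u (a : ι) : S.dm a S.u = -(S.u * (S.Γ a).transpose + S.Γ a * S.u) := by
  have h := S.dm_mul a S.g S.u
  rw [S.g_mul_u, dm_one, dm_g] at h
  have h1 : S.g * S.dm a S.u = -(((S.Γ a).transpose * S.g + S.g * S.Γ a) * S.u) :=
    eq_neg_of_add_eq_zero_right h.symm
  calc S.dm a S.u = (S.u * S.g) * S.dm a S.u := by rw [u_mul_g, one_mul]
    _ = S.u * -(((S.Γ a).transpose * S.g + S.g * S.Γ a) * S.u) := by rw [mul_assoc, h1]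
    _ = -(S.u * (S.Γ a).transpose * (S.g * S.u) + (S.u * S.g) * S.Γ a * S.u) := by noncomm_ring
    _ = _ := by rw [S.g_mul_u, u_mul_g]; noncomm_ring

/-- The curvature, `curv a b c d = R_{ab}{}^c{}_d`. -/
def curv (a b : ι) : Matrix ι ι A :=
  S.dm a (S.Γ b) - S.dm b (S.Γ a) + (S.Γ a * S.Γ b - S.Γ b * S.Γ a)

theorem curv_swap (a b : ι) : S.curv b a = -S.curv a b := by
  simp only [curv]; abel

/-- The curvature with lowered indices. -/
def lower (a b : ι) : Matrix ι ι A := S.g * S.curv a b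

theorem lower_swap (a b : ι) : S.lower b a = -S.lower a b := by
  rw [lower, curv_swap, mul_neg, lower]

theorem u_mul_lower (a b : ι) : S.u * S.lower a b = S.curv a b := by
  rw [lower, ← mul_assoc, u_mul_g, one_mul]

/-- Metric compatibility turns the equality of the mixed derivatives of `g` into `Rᵀ g + g R = 0`.
-/
theorem lower_transpose (a b : ι) : (S.lower a b).transpose = -S.lower a b := by
  have h := S.dm_comm a b S.g
  simp only [dm_g, dm_add, dm_mul, dm_transpose] at h
  rw [lower, Matrix.transpose_mul, S.g_symm, eq_neg_iff_add_eq_zero]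
  simp only [curv, Matrix.transpose_add, Matrix.transpose_sub, Matrix.transpose_mul]
  rw [← sub_eq_zero] at h
  rw [← h]
  noncomm_ring

theorem lower_swap_right (a b c d : ι) : S.lower a b d c = -S.lower a b c d := by
  have := congrFun (congrFun (S.lower_transpose a b) c) d
  simpa using this

/-- Torsion-freeness makes `(Γ_a Γ_b)^c_d` symmetric in `b` and `d`, so both the derivative and the
quadratic terms cancel in pairs. -/
theorem curv_cyclic (a b c d : ι) : S.curv a b c d + S.curv b d c a + S.curv d a c b = 0 := by
  have h (a b d : ι) : (S.Γ a * S.Γ b) c d = (S.Γ a * S.Γ d) c b := by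
    simp only [Matrix.mul_apply]
    exact Finset.sum_congr rfl fun l _ => by rw [S.torsion_free b d]
  simp only [curv, Matrix.add_apply, Matrix.sub_apply, dm_apply]
  rw [h a b d, h b a d, h d a b, S.torsion_free b d, S.torsion_free a d, S.torsion_free a b]
  ring

theorem lower_cyclic (a b c d : ι) : S.lower a b c d + S.lower b d c a + S.lower d a c b = 0 := by
  simp only [lower, Matrix.mul_apply, ← Finset.sum_add_distrib, ← mul_add, curv_cyclic, mul_zero,
    Finset.sum_const_zero]

/-- The classical octahedron argument: four cyclic identities combine, by the two skew symmetries,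
to twice the claim. Torsion-freeness of `A` cancels the 2. -/
theorem lower_pair [IsAddTorsionFree A] (a b c d : ι) : S.lower a b c d = S.lower c d a b := by
  refine nsmul_right_injective two_ne_zero ?_
  have e (a b c d : ι) : S.lower a b c d = -S.lower b a c d := by rw [S.lower_swap b a]; rfl
  have f (a b c d : ι) : S.lower a b c d = -S.lower a b d c := S.lower_swap_right a b d c
  have h1 := S.lower_cyclic a b c d
  have h2 := S.lower_cyclic b c d a
  have h3 := S.lower_cyclic c d a b
  have h4 := S.lower_cyclic d a b c
  rw [f b d, e d a] at h1
  rw [e c a, f b c] at h2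
  rw [e d b, f c d, f b c] at h3
  rw [f d a, e d a, f c d] at h4
  simp only [nsmul_eq_mul, Nat.cast_ofNat]
  have e1 := e c a d b
  have e2 := f a c b d
  grind

/-! ### Matrices acting on tensors, the covariant derivative and the Ricci identity. -/

/-- The action of a matrix on covariant tensors as a derivation. -/
def act (X : Matrix ι ι A) (T : Tens A ι k) : Tens A ι k :=
  fun I => ∑ r, ∑ l, X l (I r) * T (Function.update I r l)

theorem act_add_left (X Y : Matrix ι ι A) (T : Tens A ι k) : act (X + Y) T = act X T + act Y T := by
  ext I; simp [act, add_mul, Finset.sum_add_distrib]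

theorem act_neg_left (X : Matrix ι ι A) (T : Tens A ι k) : act (-X) T = -act X T := by
  ext I; simp [act]

theorem act_sub_left (X Y : Matrix ι ι A) (T : Tens A ι k) : act (X - Y) T = act X T - act Y T := by
  rw [sub_eq_add_neg, act_add_left, act_neg_left, sub_eq_add_neg]

theorem act_add (X : Matrix ι ι A) (T U : Tens A ι k) : act X (T + U) = act X T + act X U := by
  ext I; simp [act, mul_add, Finset.sum_add_distrib]

theorem act_neg (X : Matrix ι ι A) (T : Tens A ι k) : act X (-T) = -act X T := by
  ext I; simp [act]

theorem act_sub (X : Matrix ι ι A) (T U : Tens A ι k) : act X (T - U) = act X T - act X U := by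
  rw [sub_eq_add_neg, act_add, act_neg, sub_eq_add_neg]

/-- The part where both matrices hit the same slot is the action of `Y * X`, reversed because lower
indices form a right action; the rest hits two distinct slots. -/
theorem act_act (X Y : Matrix ι ι A) (T : Tens A ι k) (I : Fin k → ι) :
    act X (act Y T) I = act (Y * X) T I + ∑ r, ∑ s, if s = r then 0 else
      ∑ l, ∑ l', X l (I r) * Y l' (I s) * T (Function.update (Function.update I r l) s l') := by
  simp only [act, ← Finset.sum_add_distrib]
  refine Finset.sum_congr rfl fun r _ => ?_
  simp only [Finset.mul_sum]
  rw [Finset.sum_comm, ← Finset.add_sum_erase _ _ (Finset.mem_univ r),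
    ← Finset.add_sum_erase (a := r) (s := Finset.univ) (f := fun s => if s = r then _ else _)
      (Finset.mem_univ r)]
  simp only [if_true, zero_add]
  congr 1
  · simp only [Matrix.mul_apply, Finset.sum_mul, Function.update_self, Function.update_idem]
    rw [Finset.sum_comm]
    exact Finset.sum_congr rfl fun l _ => Finset.sum_congr rfl fun l' _ => by ring
  · refine Finset.sum_congr rfl fun s hs => ?_
    have hs' : s ≠ r := (Finset.mem_erase.1 hs).1
    simp only [hs', if_false, Function.update_of_ne hs']
    exact Finset.sum_congr rfl fun l _ => Finset.sum_congr rfl fun l' _ => by ring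

theorem act_commutator (X Y : Matrix ι ι A) (T : Tens A ι k) :
    act X (act Y T) - act Y (act X T) = act (Y * X - X * Y) T := by
  ext I
  simp only [act_sub_left, Pi.sub_apply, act_act]
  -- The two-slot part is symmetric in `X` and `Y`, by exchanging the slots, so it drops out of the
  -- commutator.
  have : (∑ r, ∑ s, if s = r then 0 else ∑ l, ∑ l', X l (I r) * Y l' (I s) *
        T (Function.update (Function.update I r l) s l')) =
      ∑ r, ∑ s, if s = r then 0 else ∑ l, ∑ l', Y l (I r) * X l' (I s) *
        T (Function.update (Function.update I r l) s l') := by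
    rw [Finset.sum_comm]
    refine Finset.sum_congr rfl fun r _ => Finset.sum_congr rfl fun s _ => ?_
    by_cases h : r = s
    · simp [h]
    · rw [if_neg h, if_neg (Ne.symm h), Finset.sum_comm]
      refine Finset.sum_congr rfl fun l _ => Finset.sum_congr rfl fun l' _ => ?_
      rw [Function.update_comm h]
      ring
  rw [this]
  ring

/-- The componentwise derivative of a tensor. -/
def dt (a : ι) (T : Tens A ι k) : Tens A ι k := fun I => S.D a (T I)

theorem dt_act (a : ι) (X : Matrix ι ι A) (T : Tens A ι k) :
    S.dt a (act X T) = act (S.dm a X) T + act X (S.dt a T) := by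
  ext I
  simp only [dt, act, Pi.add_apply, map_sum, Derivation.leibniz, smul_eq_mul, dm_apply,
    ← Finset.sum_add_distrib]
  exact Finset.sum_congr rfl fun r _ => Finset.sum_congr rfl fun l _ => by ring

/-- The covariant derivative in the direction of a coordinate vector field. -/
def nab (a : ι) (T : Tens A ι k) : Tens A ι k := S.dt a T - act (S.Γ a) T

theorem nab_add (a : ι) (T U : Tens A ι k) : S.nab a (T + U) = S.nab a T + S.nab a U := by
  have : S.dt a (T + U) = S.dt a T + S.dt a U := by ext I; simp [dt]
  rw [nab, this, act_add, nab, nab]; abel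

theorem nab_neg (a : ι) (T : Tens A ι k) : S.nab a (-T) = -S.nab a T := by
  have : S.dt a (-T) = -S.dt a T := by ext I; simp [dt]
  rw [nab, this, act_neg, nab]; abel

theorem nab_sub (a : ι) (T U : Tens A ι k) : S.nab a (T - U) = S.nab a T - S.nab a U := by
  rw [sub_eq_add_neg, nab_add, nab_neg, sub_eq_add_neg]

/-- Here `a` and `b` are labels of vector fields, not tensor slots, so no `Γ` acts on them. The sign
is that of covariant indices. -/
theorem nab_nab_sub (a b : ι) (T : Tens A ι k) :
    S.nab a (S.nab b T) - S.nab b (S.nab a T) = -act (S.curv a b) T := by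
  have hsub (a : ι) (T U : Tens A ι k) : S.dt a (T - U) = S.dt a T - S.dt a U := by
    ext I; simp [dt]
  have hcomm : S.dt a (S.dt b T) = S.dt b (S.dt a T) := by ext I; exact S.D_comm _ _ _
  have h := act_commutator (S.Γ a) (S.Γ b) T
  rw [act_sub_left] at h
  simp only [nab, hsub, dt_act, act_sub, hcomm, curv, act_sub_left, act_add_left]
  rw [sub_eq_iff_eq_add] at h
  rw [h]; abel

/-- The covariant derivative of a matrix as a tensor with one upper and one lower index. -/
def nabMat (a : ι) (X : Matrix ι ι A) : Matrix ι ι A := S.dm a X + S.Γ a * X - X * S.Γ a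

theorem nab_act (a : ι) (X : Matrix ι ι A) (T : Tens A ι k) :
    S.nab a (act X T) = act (S.nabMat a X) T + act X (S.nab a T) := by
  have h := act_commutator (S.Γ a) X T
  rw [act_sub_left, sub_eq_iff_eq_add] at h
  simp only [nab, dt_act, act_sub, nabMat, act_sub_left, act_add_left]
  rw [h]; abel

/-- This transfers every index symmetry of a tensor to its covariant derivative. -/
theorem nab_perm (a : ι) (T : Tens A ι k) (σ : Equiv.Perm (Fin k)) (I : Fin k → ι) :
    S.nab a (fun J => T (J ∘ σ)) I = S.nab a T (I ∘ σ) := by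
  simp only [nab, Pi.sub_apply, dt, act]
  congr 1
  rw [← Equiv.sum_comp σ]
  refine Finset.sum_congr rfl fun r _ => Finset.sum_congr rfl fun l _ => ?_
  rw [Function.update_comp_equiv, Equiv.symm_apply_apply]
  rfl

/-- The covariant derivative, with the new index first. -/
def cov (T : Tens A ι k) : Tens A ι (k + 1) := fun I => S.nab (I 0) T (Fin.tail I)

@[simp] theorem cov_cons (T : Tens A ι k) (a : ι) (I : Fin k → ι) :
    S.cov T (Fin.cons a I) = S.nab a T I := rfl

theorem act_cons (X : Matrix ι ι A) (T : Tens A ι (k + 1)) (a : ι) (I : Fin k → ι) :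
    act X T (Fin.cons a I) = ∑ l, X l a * T (Fin.cons l I) +
      act X (fun J => T (Fin.cons a J)) I := by
  simp only [act, Fin.sum_univ_succ, Fin.cons_zero, Fin.update_cons_zero, Fin.cons_succ,
    ← Fin.cons_update]

/-- Passing from `b` as a frozen parameter to `b` as a tensor slot costs one `Γ` term. -/
theorem nab_cons (a b : ι) (T : Tens A ι (k + 1)) (I : Fin k → ι) :
    S.nab a T (Fin.cons b I) = S.nab a (fun J => T (Fin.cons b J)) I -
      ∑ l, S.Γ a l b * T (Fin.cons l I) := by
  simp only [nab, Pi.sub_apply, act_cons, dt]; ring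

theorem cov_cov_sub (T : Tens A ι k) (a b : ι) (I : Fin k → ι) :
    S.cov (S.cov T) (Fin.cons a (Fin.cons b I)) - S.cov (S.cov T) (Fin.cons b (Fin.cons a I)) =
      -act (S.curv a b) T I := by
  have h := congrFun (S.nab_nab_sub a b T) I
  simp only [cov_cons, nab_cons]
  simp only [Pi.sub_apply, Pi.neg_apply] at h
  -- The `Γ` terms acting on the new slot agree in both orders and cancel.
  simp only [S.torsion_free a b]
  rw [← h]
  change S.nab a (S.nab b T) I - _ - (S.nab b (S.nab a T) I - _) = _
  ring

theorem act_sum_left {α : Type*} (t : Finset α) (X : α → Matrix ι ι A) (T : Tens A ι k) :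
    act (∑ i ∈ t, X i) T = ∑ i ∈ t, act (X i) T := by
  classical
  induction t using Finset.induction_on with
  | empty => ext I; simp [act]
  | insert i t hi ih => rw [Finset.sum_insert hi, Finset.sum_insert hi, act_add_left, ih]

theorem act_smul_left (c : A) (X : Matrix ι ι A) (T : Tens A ι k) :
    act (c • X) T = c • act X T := by
  ext I; simp [act, Finset.mul_sum, mul_assoc]

theorem act_smul (c : A) (X : Matrix ι ι A) (T : Tens A ι k) :
    act X (c • T) = c • act X T := by
  ext I
  simp only [act, Pi.smul_apply, smul_eq_mul, Finset.mul_sum]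
  exact Finset.sum_congr rfl fun r _ => Finset.sum_congr rfl fun l _ => by ring

theorem nab_smul (a : ι) (c : A) (T : Tens A ι k) :
    S.nab a (c • T) = S.D a c • T + c • S.nab a T := by
  rw [nab, act_smul, nab, smul_sub, ← add_sub_assoc]
  congr 1
  ext I
  simp [dt]; ring

theorem nab_sum {α : Type*} (a : ι) (t : Finset α) (T : α → Tens A ι k) :
    S.nab a (∑ i ∈ t, T i) = ∑ i ∈ t, S.nab a (T i) := by
  classical
  induction t using Finset.induction_on with
  | empty => ext I; simp [nab, act, dt]
  | insert i t hi ih => rw [Finset.sum_insert hi, Finset.sum_insert hi, nab_add, ih]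

/-! ### Contractions, the Laplacian and the second Bianchi identity. -/

/-- Contraction of the first two indices with the inverse metric. -/
def contr (T : Tens A ι (k + 2)) : Tens A ι k :=
  fun I => ∑ e, ∑ f, S.u e f * T (Fin.cons e (Fin.cons f I))

/-- The inverse metric is parallel: its derivative `dm_u` cancels the `Γ` terms of the two
contracted slots. -/
theorem nab_contr (a : ι) (T : Tens A ι (k + 2)) (I : Fin k → ι) :
    S.nab a (S.contr T) I = ∑ e, ∑ f, S.u e f * S.nab a T (Fin.cons e (Fin.cons f I)) := by
  have hu (e f : ι) : S.D a (S.u e f) =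
      -(∑ l, S.u e l * S.Γ a f l) - ∑ l, S.Γ a e l * S.u l f := by
    have := congrFun (congrFun (S.dm_u a) e) f
    simp only [dm_apply, Matrix.neg_apply, Matrix.add_apply, Matrix.mul_apply,
      Matrix.transpose_apply] at this
    rw [this]; ring
  have hc : S.contr T = ∑ e, ∑ f, S.u e f • fun J => T (Fin.cons e (Fin.cons f J)) := by
    ext J; simp [contr]
  have h1 : ∑ e, ∑ f, (∑ l, S.u e l * S.Γ a f l) * T (Fin.cons e (Fin.cons f I)) =
      ∑ e, ∑ f, S.u e f * ∑ l, S.Γ a l f * T (Fin.cons e (Fin.cons l I)) := by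
    refine Finset.sum_congr rfl fun e _ => ?_
    simp only [Finset.mul_sum, Finset.sum_mul]
    rw [Finset.sum_comm]
    exact Finset.sum_congr rfl fun l _ => Finset.sum_congr rfl fun f _ => by ring
  have h2 : ∑ e, ∑ f, (∑ l, S.Γ a e l * S.u l f) * T (Fin.cons e (Fin.cons f I)) =
      ∑ e, ∑ f, S.u e f * ∑ l, S.Γ a l e * T (Fin.cons l (Fin.cons f I)) := by
    rw [Finset.sum_comm, Finset.sum_comm (γ := ι) (f := fun e f => S.u e f * _)]
    refine Finset.sum_congr rfl fun e _ => ?_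
    simp only [Finset.mul_sum, Finset.sum_mul]
    rw [Finset.sum_comm]
    exact Finset.sum_congr rfl fun l _ => Finset.sum_congr rfl fun f _ => by ring
  rw [hc]
  simp only [nab_sum, nab_smul, nab_cons, Finset.sum_apply, Pi.add_apply, Pi.smul_apply,
    smul_eq_mul, hu, mul_sub, sub_mul, neg_mul, Finset.sum_add_distrib, Finset.sum_sub_distrib,
    Finset.sum_neg_distrib, h1, h2]
  ring

/-- The Laplacian. -/
def lap (T : Tens A ι k) : Tens A ι k := S.contr (S.cov (S.cov T))

/-- The covariant derivative of the curvature, `covCurv f a b c d = ∇_f R_{ab}{}^c{}_d`. -/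
def covCurv (f a b : ι) : Matrix ι ι A :=
  S.nabMat f (S.curv a b) - ∑ l, S.Γ f l a • S.curv l b - ∑ l, S.Γ f l b • S.curv a l

theorem covCurv_swap (f a b : ι) : S.covCurv f b a = -S.covCurv f a b := by
  have h (X : Matrix ι ι A) : S.dm f (-X) = -S.dm f X := by ext i j; simp [dm_apply]
  simp only [covCurv, nabMat, S.curv_swap a, S.curv_swap _ b, h, smul_neg, Finset.sum_neg_distrib]
  noncomm_ring

theorem covCurv_cyclic (a b c : ι) : S.covCurv a b c + S.covCurv b c a + S.covCurv c a b = 0 := by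
  -- This is the Jacobi identity for the operators `∂_a + Γ_a`, whose commutators are the
  -- curvatures. The `Γ` terms on the two form indices cancel by torsion-freeness.
  have h : S.nabMat a (S.curv b c) + S.nabMat b (S.curv c a) + S.nabMat c (S.curv a b) = 0 := by
    simp only [nabMat, curv, dm_add, dm_sub, dm_mul]
    rw [S.dm_comm b a, S.dm_comm c a, S.dm_comm c b]
    noncomm_ring
  have hs (a b c : ι) : ∑ l, S.Γ a l b • S.curv c l = -∑ l, S.Γ b l a • S.curv l c := by
    rw [← Finset.sum_neg_distrib]
    exact Finset.sum_congr rfl fun l _ => by rw [S.torsion_free a, S.curv_swap l c, smul_neg]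
  simp only [covCurv]
  rw [hs a c b, hs b a c, hs c b a, ← h]
  abel

/-- The curvature tensor with all indices lowered. -/
def riem : Tens A ι 4 := fun I => S.lower (I 0) (I 1) (I 2) (I 3)

/-- The Ricci tensor. -/
def ric : Tens A ι 2 := fun I => ∑ c, S.curv c (I 0) c (I 1)

theorem nab_riem (f a b c d : ι) :
    S.nab f S.riem ![a, b, c, d] = (S.g * S.covCurv f a b) c d := by
  have h : S.dm f (S.lower a b) = (S.Γ f).transpose * S.lower a b + S.lower a b * S.Γ f +
      S.g * S.nabMat f (S.curv a b) := by
    rw [lower, dm_mul, dm_g, nabMat]; noncomm_ring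
  have h' := congrFun (congrFun h c) d
  have h0 (l : ι) : Function.update ![a, b, c, d] 0 l = ![l, b, c, d] := by
    ext i; fin_cases i <;> rfl
  have h1 (l : ι) : Function.update ![a, b, c, d] 1 l = ![a, l, c, d] := by
    ext i; fin_cases i <;> rfl
  have h2 (l : ι) : Function.update ![a, b, c, d] 2 l = ![a, b, l, d] := by
    ext i; fin_cases i <;> rfl
  have h3 (l : ι) : Function.update ![a, b, c, d] 3 l = ![a, b, c, l] := by
    ext i; fin_cases i <;> rfl
  have hr (a b c d : ι) : S.riem ![a, b, c, d] = S.lower a b c d := rfl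
  have hs : (S.g * S.covCurv f a b) c d = (S.g * S.nabMat f (S.curv a b)) c d -
      ∑ l, S.Γ f l a * S.lower l b c d - ∑ l, S.Γ f l b * S.lower a l c d := by
    simp only [covCurv, mul_sub, Finset.mul_sum, Matrix.mul_smul, Matrix.sub_apply,
      Matrix.sum_apply, Matrix.smul_apply, smul_eq_mul, lower]
  rw [hs, nab, Pi.sub_apply, dt, act, Fin.sum_univ_four]
  simp only [h0, h1, h2, h3, hr]
  simp only [dm_apply, Matrix.add_apply, Matrix.mul_apply (M := (S.Γ f).transpose),
    Matrix.mul_apply (N := S.Γ f), Matrix.transpose_apply] at h'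
  rw [h']
  simp only [Matrix.cons_val, mul_comm (S.lower a b c _)]
  ring

theorem nab_ric (f a b : ι) : S.nab f S.ric ![a, b] = ∑ c, S.covCurv f c a c b := by
  have h0 (l : ι) : Function.update ![a, b] 0 l = ![l, b] := by
    ext i; fin_cases i <;> rfl
  have h1 (l : ι) : Function.update ![a, b] 1 l = ![a, l] := by
    ext i; fin_cases i <;> rfl
  have hr (a b : ι) : S.ric ![a, b] = ∑ c, S.curv c a c b := rfl
  have e1 : ∑ c, ∑ l, S.Γ f c l * S.curv c a l b = ∑ c, ∑ l, S.Γ f l c * S.curv l a c b :=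
    Finset.sum_comm
  have e2 : ∑ l, S.Γ f l a * ∑ c, S.curv c l c b = ∑ c, ∑ l, S.Γ f l a * S.curv c l c b := by
    simp only [Finset.mul_sum]; exact Finset.sum_comm
  have e3 : ∑ l, S.Γ f l b * ∑ c, S.curv c a c l = ∑ c, ∑ l, S.curv c a c l * S.Γ f l b := by
    simp only [Finset.mul_sum]
    rw [Finset.sum_comm]
    exact Finset.sum_congr rfl fun c _ => Finset.sum_congr rfl fun l _ => mul_comm _ _
  rw [nab, Pi.sub_apply, dt, act, Fin.sum_univ_two]
  simp only [h0, h1, hr, Matrix.cons_val, e2, e3, map_sum]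
  simp only [covCurv, nabMat, Matrix.sub_apply, Matrix.add_apply, Matrix.sum_apply,
    Matrix.smul_apply, smul_eq_mul, Matrix.mul_apply, dm_apply, Finset.sum_sub_distrib,
    Finset.sum_add_distrib]
  rw [e1]; ring

end MetricConnection

/-! ### Contracted Bianchi identity and the Laplacian of the curvature. -/

namespace MetricConnection

set_option linter.unusedSectionVars false

variable {A ι : Type*} [CommRing A] [Fintype ι] [DecidableEq ι] (S : MetricConnection A ι)
variable {k : ℕ}

theorem u_symm (i j : ι) : S.u i j = S.u j i := by
  have h : S.u.transpose = S.u := by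
    have h1 : S.u.transpose * S.g = 1 := by
      rw [← S.g_symm, ← Matrix.transpose_mul, S.g_mul_u, Matrix.transpose_one]
    calc S.u.transpose = S.u.transpose * (S.g * S.u) := by rw [S.g_mul_u, mul_one]
      _ = S.u := by rw [← mul_assoc, h1, one_mul]
  exact congrFun (congrFun h j) i

/-- The tensor `∇_b Ric_{ca} - ∇_c Ric_{ba}`, with indices in the order `b, c, a`. -/
def skew : Tens A ι 3 :=
  fun I => S.nab (I 0) S.ric ![I 1, I 2] - S.nab (I 1) S.ric ![I 0, I 2]

theorem nab_riem_pair [IsAddTorsionFree A] (f a b c d : ι) :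
    S.nab f S.riem ![a, b, c, d] = S.nab f S.riem ![c, d, a, b] := by
  let σ : Equiv.Perm (Fin 4) := ⟨![2, 3, 0, 1], ![2, 3, 0, 1], by decide, by decide⟩
  have h : (fun J => S.riem (J ∘ σ)) = S.riem := by
    funext J
    exact S.lower_pair _ _ _ _
  have h' := S.nab_perm f S.riem σ ![a, b, c, d]
  rw [h] at h'
  rw [h']
  congr 1
  funext i; fin_cases i <;> rfl

theorem u_mul_nab_riem (f a b c d : ι) :
    ∑ m, S.u c m * S.nab f S.riem ![a, b, m, d] = S.covCurv f a b c d := by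
  simp only [nab_riem]
  rw [← Matrix.mul_apply, ← mul_assoc, u_mul_g, one_mul]

/-- The contracted second Bianchi identity. -/
theorem div_riem [IsAddTorsionFree A] (a b c : ι) :
    ∑ e, ∑ f, S.u e f * S.nab f S.riem ![e, a, b, c] = S.skew ![b, c, a] := by
  have h (f : ι) : ∑ e, S.u e f * S.nab f S.riem ![e, a, b, c] =
      S.covCurv b f c f a - S.covCurv c f b f a := by
    have h1 := S.u_mul_nab_riem f b c f a
    -- Second Bianchi at the diagonal entry `c = f`: summing over `f` turns the two other terms into
    -- derivatives of the Ricci tensor.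
    have h2 := congrFun (congrFun (S.covCurv_cyclic f b c) f) a
    rw [S.covCurv_swap b f c] at h2
    simp only [Matrix.add_apply, Matrix.neg_apply, Matrix.zero_apply] at h2
    simp only [S.nab_riem_pair f _ a b c, S.u_symm _ f]
    rw [h1]
    linear_combination h2
  rw [Finset.sum_comm]
  simp only [h, Finset.sum_sub_distrib, skew, nab_ric, Matrix.cons_val]

theorem contr_cov_riem [IsAddTorsionFree A] :
    S.contr (S.cov S.riem) = fun J => S.skew ![J 1, J 2, J 0] := by
  funext J
  rw [← S.div_riem (J 0) (J 1) (J 2), contr]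
  have : J = ![J 0, J 1, J 2] := by funext i; fin_cases i <;> rfl
  rw [Finset.sum_comm]
  refine Finset.sum_congr rfl fun e _ => Finset.sum_congr rfl fun f _ => ?_
  rw [S.u_symm, this]; rfl

theorem nab_contr_cov_riem [IsAddTorsionFree A] (f a b c : ι) :
    S.nab f (S.contr (S.cov S.riem)) ![a, b, c] = S.nab f S.skew ![b, c, a] := by
  let σ : Equiv.Perm (Fin 3) := ⟨![1, 2, 0], ![2, 0, 1], by decide, by decide⟩
  have h : (fun J => S.skew (J ∘ σ)) = S.contr (S.cov S.riem) := by
    rw [contr_cov_riem]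
    funext J
    congr 1
    funext i; fin_cases i <;> rfl
  rw [← h, nab_perm]
  congr 1
  funext i; fin_cases i <;> rfl

theorem cov_cov_riem_swap (e f a b c d : ι) :
    S.nab e (S.cov S.riem) ![f, b, a, c, d] = -S.nab e (S.cov S.riem) ![f, a, b, c, d] := by
  let σ : Equiv.Perm (Fin 5) := Equiv.swap 1 2
  have h : (fun J => S.cov S.riem (J ∘ σ)) = -S.cov S.riem := by
    funext J
    have e1 : J ∘ σ = Fin.cons (J 0) ![J 2, J 1, J 3, J 4] := by
      funext i; fin_cases i <;> rfl
    have e2 : J = Fin.cons (J 0) ![J 1, J 2, J 3, J 4] := by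
      funext i; fin_cases i <;> rfl
    rw [Pi.neg_apply, e1, cov_cons, nab_riem, covCurv_swap]
    conv_rhs => rw [e2, cov_cons, nab_riem]
    simp
  have h' := S.nab_perm e (S.cov S.riem) σ ![f, a, b, c, d]
  rw [h, nab_neg, Pi.neg_apply] at h'
  rw [h']
  congr 1
  funext i; fin_cases i <;> rfl

theorem cov_cov_riem_cyclic (e f a b c d : ι) :
    S.nab e (S.cov S.riem) ![f, a, b, c, d] + S.nab e (S.cov S.riem) ![a, b, f, c, d] +
      S.nab e (S.cov S.riem) ![b, f, a, c, d] = 0 := by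
  let σ : Equiv.Perm (Fin 5) := ⟨![1, 2, 0, 3, 4], ![2, 0, 1, 3, 4], by decide, by decide⟩
  let τ : Equiv.Perm (Fin 5) := ⟨![2, 0, 1, 3, 4], ![1, 2, 0, 3, 4], by decide, by decide⟩
  have h : S.cov S.riem + (fun J => S.cov S.riem (J ∘ σ)) + (fun J => S.cov S.riem (J ∘ τ)) = 0 := by
    funext J
    have e0 : J = Fin.cons (J 0) ![J 1, J 2, J 3, J 4] := by
      funext i; fin_cases i <;> rfl
    have e1 : J ∘ σ = Fin.cons (J 1) ![J 2, J 0, J 3, J 4] := by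
      funext i; fin_cases i <;> rfl
    have e2 : J ∘ τ = Fin.cons (J 2) ![J 0, J 1, J 3, J 4] := by
      funext i; fin_cases i <;> rfl
    have hJ : S.cov S.riem J = (S.g * S.covCurv (J 0) (J 1) (J 2)) (J 3) (J 4) := by
      conv_lhs => rw [e0]
      rw [cov_cons, nab_riem]
    have hc : S.g * S.covCurv (J 0) (J 1) (J 2) + S.g * S.covCurv (J 1) (J 2) (J 0) +
        S.g * S.covCurv (J 2) (J 0) (J 1) = 0 := by
      rw [← mul_add, ← mul_add, covCurv_cyclic, mul_zero]
    simp only [Pi.add_apply]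
    rw [e1, e2, hJ, cov_cons, cov_cons, nab_riem, nab_riem]
    exact congrFun (congrFun hc (J 3)) (J 4)
  have h' := congrFun (congrArg (S.nab e) h) ![f, a, b, c, d]
  have h0 : S.nab e (0 : Tens A ι 5) = 0 := by
    ext I; simp [nab, dt, act]
  rw [h0, nab_add, nab_add, Pi.add_apply, Pi.add_apply, nab_perm, nab_perm] at h'
  rw [Pi.zero_apply] at h'
  rw [← h']
  congr 1

/-- Half of the quadratic terms in the Laplacian of the curvature. -/
def quad (a b c d : ι) : A :=
  ∑ e, ∑ f, S.u e f * act (S.curv e a) S.riem ![f, b, c, d]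

/-- The Ricci identity exchanges `e` and `a`; then `∇_a` commutes with the contraction and meets the
divergence of the curvature. -/
theorem contr_nab_cov_riem [IsAddTorsionFree A] (a b c d : ι) :
    ∑ e, ∑ f, S.u e f * S.cov (S.cov S.riem) ![e, a, f, b, c, d] =
      S.nab a S.skew ![c, d, b] - S.quad a b c d := by
  have h (e f : ι) : S.cov (S.cov S.riem) ![e, a, f, b, c, d] =
      S.nab a (S.cov S.riem) ![e, f, b, c, d] - act (S.curv e a) S.riem ![f, b, c, d] := by
    rw [sub_eq_add_neg, ← sub_eq_iff_eq_add']
    exact S.cov_cov_sub S.riem e a ![f, b, c, d]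
  simp only [h, mul_sub, Finset.sum_sub_distrib]
  rw [quad, ← nab_contr_cov_riem, nab_contr]
  rfl

theorem lap_riem [IsAddTorsionFree A] (a b c d : ι) :
    S.lap S.riem ![a, b, c, d] = S.nab a S.skew ![c, d, b] - S.nab b S.skew ![c, d, a] +
      (S.quad b a c d - S.quad a b c d) := by
  -- The second Bianchi identity under one further derivative.
  have h (e f : ι) : S.cov (S.cov S.riem) ![e, f, a, b, c, d] =
      S.cov (S.cov S.riem) ![e, a, f, b, c, d] - S.cov (S.cov S.riem) ![e, b, f, a, c, d] := by
    have h1 := S.cov_cov_riem_cyclic e f a b c d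
    have h2 := S.cov_cov_riem_swap e a f b c d
    change S.nab e (S.cov S.riem) ![f, a, b, c, d] = S.nab e (S.cov S.riem) ![a, f, b, c, d] -
      S.nab e (S.cov S.riem) ![b, f, a, c, d]
    linear_combination h1 - h2
  have h' : S.lap S.riem ![a, b, c, d] =
      ∑ e, ∑ f, S.u e f * S.cov (S.cov S.riem) ![e, f, a, b, c, d] := rfl
  rw [h']
  simp only [h, mul_sub, Finset.sum_sub_distrib, contr_nab_cov_riem]
  ring

end MetricConnection

/-! ### The commutator of the Laplacian with the covariant derivative. -/

namespace MetricConnection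

set_option linter.unusedSectionVars false

variable {A ι : Type*} [CommRing A] [Fintype ι] [DecidableEq ι] (S : MetricConnection A ι)
variable {k : ℕ}

theorem contr_contr_comm (F : ι → ι → A) :
    ∑ e, ∑ f, S.u e f * F f e = ∑ e, ∑ f, S.u e f * F e f := by
  rw [Finset.sum_comm]
  exact Finset.sum_congr rfl fun e _ => Finset.sum_congr rfl fun f _ => by rw [S.u_symm]

theorem contr_sum {α : Type*} [Fintype α] (F : ι → ι → α → A) :
    ∑ e, ∑ f, S.u e f * ∑ l, F e f l = ∑ l, ∑ e, ∑ f, S.u e f * F e f l := by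
  simp only [Finset.mul_sum]
  rw [Finset.sum_comm (s := (Finset.univ : Finset α))]
  exact Finset.sum_congr rfl fun e _ => Finset.sum_comm

theorem contr_mul_right (F : ι → ι → A) (x : A) :
    ∑ e, ∑ f, S.u e f * (F e f * x) = (∑ e, ∑ f, S.u e f * F e f) * x := by
  simp only [Finset.sum_mul, mul_assoc]

theorem contr_mul_left (F : ι → ι → A) (x : A) :
    ∑ e, ∑ f, S.u e f * (x * F e f) = x * ∑ e, ∑ f, S.u e f * F e f := by
  simp only [Finset.mul_sum, mul_left_comm x]

/-- The covariant derivative of the Ricci identity in the slots `f`, `c`. -/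
theorem nab_cov_cov (T : Tens A ι k) (e f c : ι) (I : Fin k → ι) :
    S.nab e (S.cov (S.cov T)) (Fin.cons f (Fin.cons c I)) =
      S.nab e (S.cov (S.cov T)) (Fin.cons c (Fin.cons f I)) - act (S.covCurv e f c) T I -
        act (S.curv f c) (S.nab e T) I := by
  let σ : Equiv.Perm (Fin (k + 2)) := Equiv.swap 0 1
  have hσ (f c : ι) (I : Fin k → ι) :
      (Fin.cons f (Fin.cons c I) : Fin (k + 2) → ι) ∘ σ = Fin.cons c (Fin.cons f I) := by
    funext i
    refine Fin.cases ?_ (fun i => Fin.cases ?_ (fun i => ?_) i) i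
    · simp [σ]
    · simp [σ]
    · have : σ i.succ.succ = i.succ.succ :=
        Equiv.swap_apply_of_ne_of_ne (Fin.succ_ne_zero _) (by simp [Fin.ext_iff])
      simp [this]
  have hI (I : Fin (k + 2) → ι) :
      I = Fin.cons (I 0) (Fin.cons (Fin.tail I 0) (Fin.tail (Fin.tail I))) := by simp
  -- The curvature term as a tensor of rank `k + 2`: the `Γ` terms of its two leading slots complete
  -- `nabMat` to `covCurv`.
  let Q : Tens A ι (k + 2) := fun J => act (S.curv (J 0) (Fin.tail J 0)) T (Fin.tail (Fin.tail J))
  have hQ : S.cov (S.cov T) = (fun J => S.cov (S.cov T) (J ∘ σ)) - Q := by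
    funext J
    rw [Pi.sub_apply]
    have h := S.cov_cov_sub T (J 0) (Fin.tail J 0) (Fin.tail (Fin.tail J))
    rw [← hσ (J 0) (Fin.tail J 0), ← hI J] at h
    change S.cov (S.cov T) J = S.cov (S.cov T) (J ∘ σ) -
      act (S.curv (J 0) (Fin.tail J 0)) T (Fin.tail (Fin.tail J))
    linear_combination h
  have hnQ : S.nab e Q (Fin.cons f (Fin.cons c I)) = act (S.covCurv e f c) T I +
      act (S.curv f c) (S.nab e T) I := by
    have h1 (f c : ι) (I : Fin k → ι) : Q (Fin.cons f (Fin.cons c I)) = act (S.curv f c) T I := rfl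
    rw [nab_cons, nab_cons]
    simp only [h1, nab_act, covCurv, act_sub_left, act_sum_left, act_smul_left, Pi.sub_apply,
      Pi.add_apply, Finset.sum_apply, Pi.smul_apply, smul_eq_mul]
    ring
  conv_lhs => rw [hQ]
  rw [nab_sub, Pi.sub_apply, nab_perm, hσ, hnQ]
  ring

theorem contr_covCurv [IsAddTorsionFree A] (c l d : ι) :
    ∑ e, ∑ f, S.u e f * S.covCurv e f c l d = ∑ m, S.u l m * S.skew ![m, d, c] := by
  simp only [← u_mul_nab_riem, contr_sum, contr_mul_left, ← div_riem]
  refine Finset.sum_congr rfl fun m _ => ?_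
  rw [S.contr_contr_comm fun e f => S.nab e S.riem ![f, c, m, d]]

/-- The minus sign comes from the skew symmetry of the last pair, needed to reach the trace defining
`ric`. -/
theorem contr_curv (c l : ι) :
    ∑ e, ∑ f, S.u e f * S.curv e c l f = -∑ m, S.u l m * S.ric ![c, m] := by
  have h (e : ι) : S.curv e c l = fun f => ∑ m, S.u l m * S.lower e c m f := by
    funext f
    rw [← u_mul_lower, Matrix.mul_apply]
  have h' (m : ι) : ∑ e, ∑ f, S.u e f * S.lower e c m f = -S.ric ![c, m] := by
    have : S.ric ![c, m] = ∑ e, S.curv e c e m := rfl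
    rw [this, ← Finset.sum_neg_distrib]
    refine Finset.sum_congr rfl fun e _ => ?_
    rw [← u_mul_lower, Matrix.mul_apply, ← Finset.sum_neg_distrib]
    exact Finset.sum_congr rfl fun f _ => by rw [S.lower_swap_right e c f m, mul_neg]
  simp only [h, contr_sum, contr_mul_left, h', mul_neg, Finset.sum_neg_distrib]

/-- The commutator of the Laplacian and the covariant derivative. -/
theorem lap_cov_sub [IsAddTorsionFree A] (T : Tens A ι k) (c : ι) (I : Fin k → ι) :
    S.lap (S.cov T) (Fin.cons c I) - S.cov (S.lap T) (Fin.cons c I) =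
      -(∑ r, ∑ e, ∑ f, S.u e f * (T (Function.update I r e) * S.skew ![f, I r, c])) -
      2 * (∑ r, ∑ e, ∑ e', ∑ f, S.u e e' *
        (S.curv e c f (I r) * S.cov T (Fin.cons e' (Function.update I r f)))) +
      ∑ e, ∑ e', S.u e e' * (S.ric ![c, e] * S.cov T (Fin.cons e' I)) := by
  have h (e f : ι) : S.cov (S.cov (S.cov T)) (Fin.cons e (Fin.cons f (Fin.cons c I))) =
      S.nab c (S.cov (S.cov T)) (Fin.cons e (Fin.cons f I)) -
        (∑ l, S.curv e c l f * S.nab l T I + act (S.curv e c) (S.nab f T) I) -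
        act (S.covCurv e f c) T I - act (S.curv f c) (S.nab e T) I := by
    -- For `∇T` the curvature also acts on the slot `f`, which `act_cons` splits off; its trace is
    -- the Ricci term `e1`.
    have h1 := S.cov_cov_sub (S.cov T) e c (Fin.cons f I)
    rw [act_cons] at h1
    simp only [cov_cons] at h1 ⊢
    rw [nab_cov_cov]
    linear_combination h1
  have e1 : ∑ e, ∑ f, S.u e f * ∑ l, S.curv e c l f * S.nab l T I =
      -∑ e, ∑ e', S.u e e' * (S.ric ![c, e] * S.nab e' T I) := by
    simp only [contr_sum, contr_mul_right]
    simp only [contr_curv, neg_mul, Finset.sum_neg_distrib, Finset.sum_mul]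
    rw [Finset.sum_comm]
    congr 1
    exact Finset.sum_congr rfl fun e _ => Finset.sum_congr rfl fun f _ => by
      rw [S.u_symm]; ring
  have e2 : ∑ e, ∑ f, S.u e f * act (S.covCurv e f c) T I =
      ∑ r, ∑ e, ∑ f, S.u e f * (T (Function.update I r e) * S.skew ![f, I r, c]) := by
    simp only [act, contr_sum, contr_mul_right]
    simp only [contr_covCurv, Finset.sum_mul]
    exact Finset.sum_congr rfl fun r _ => Finset.sum_congr rfl fun e _ =>
      Finset.sum_congr rfl fun f _ => by ring
  have e3 : ∑ e, ∑ f, S.u e f * act (S.curv f c) (S.nab e T) I =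
      ∑ e, ∑ f, S.u e f * act (S.curv e c) (S.nab f T) I :=
    S.contr_contr_comm fun e f => act (S.curv e c) (S.nab f T) I
  have e4 : ∑ e, ∑ f, S.u e f * act (S.curv e c) (S.nab f T) I = ∑ r, ∑ e, ∑ e', ∑ f, S.u e e' *
      (S.curv e c f (I r) * S.nab e' T (Function.update I r f)) := by
    simp only [act]
    rw [S.contr_sum]
    simp only [Finset.mul_sum]
  have e5 : S.lap (S.cov T) (Fin.cons c I) = ∑ e, ∑ f, S.u e f *
      S.cov (S.cov (S.cov T)) (Fin.cons e (Fin.cons f (Fin.cons c I))) := rfl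
  rw [e5]
  simp only [h, mul_sub, mul_add, Finset.sum_sub_distrib, Finset.sum_add_distrib, e1, e2, e3, e4,
    cov_cons]
  rw [lap, nab_contr]
  ring

end MetricConnection

/-! ### The quadratic terms as universal contractions. -/

namespace MetricConnection

set_option linter.unusedSectionVars false

section Quadratic

variable {A ι : Type*} [CommRing A] [Fintype ι] [DecidableEq ι] (S : MetricConnection A ι)

/-- The partial contraction of two copies of the curvature tensor described by a permutation of the
eight index slots. -/
def contrSq (σ : Equiv.Perm (Fin (4 + 4))) : Tens A ι 4 :=
  fun I => ∑ J : Fin 4 → ι, S.u (J 0) (J 1) * S.u (J 2) (J 3) *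
    (S.riem (fun r => (Fin.append I J : Fin (4 + 4) → ι) (σ (Fin.castAdd 4 r))) *
      S.riem (fun r => (Fin.append I J : Fin (4 + 4) → ι) (σ (Fin.natAdd 4 r))))

theorem sum_fin_cons {k : ℕ} (F : (Fin (k + 1) → ι) → A) :
    ∑ J, F J = ∑ a, ∑ J, F (Fin.cons a J) := by
  rw [← Fintype.sum_prod_type', ← (Fin.consEquiv fun _ => ι).sum_comp]
  rfl

theorem sum_fin_four (F : (Fin 4 → ι) → A) :
    ∑ J, F J = ∑ e, ∑ f, ∑ l, ∑ m, F ![e, f, l, m] := by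
  simp only [sum_fin_cons, Fintype.sum_unique]
  rfl

/-- The permutations of the terms of `quad`. -/
def quadPerm : Fin 4 → Equiv.Perm (Fin (4 + 4)) :=
  -- Slots `0` to `3` are the free `a, b, c, d`, and `4` to `7` the dummies `e, f, l, m`, paired as
  -- `ef` and `lm`. The first factor is `R_{eamx}`; the second is `R_{fbcd}` with `x`, its `i`-th
  -- index, replaced by `l`.
  ![⟨![4, 0, 7, 5, 6, 1, 2, 3], ![1, 5, 6, 7, 0, 3, 4, 2], by decide, by decide⟩,
    ⟨![4, 0, 7, 1, 5, 6, 2, 3], ![1, 3, 6, 7, 0, 4, 5, 2], by decide, by decide⟩,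
    ⟨![4, 0, 7, 2, 5, 1, 6, 3], ![1, 5, 3, 7, 0, 4, 6, 2], by decide, by decide⟩,
    ⟨![4, 0, 7, 3, 5, 1, 2, 6], ![1, 5, 6, 3, 0, 4, 7, 2], by decide, by decide⟩]

theorem quad_eq_sum (a b c d : ι) :
    S.quad a b c d = ∑ i, S.contrSq (quadPerm i) ![a, b, c, d] := by
  have hc (e x l : ι) : S.curv e a l x = ∑ m, S.u l m * S.lower e a m x := by
    rw [← u_mul_lower, Matrix.mul_apply]
  have h0 (e f l m : ι) :
      S.riem (fun r => (Fin.append ![a, b, c, d] ![e, f, l, m]) (quadPerm 0 (Fin.castAdd 4 r))) *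
      S.riem (fun r => (Fin.append ![a, b, c, d] ![e, f, l, m]) (quadPerm 0 (Fin.natAdd 4 r))) =
      S.lower e a m f * S.lower l b c d := rfl
  have h1 (e f l m : ι) :
      S.riem (fun r => (Fin.append ![a, b, c, d] ![e, f, l, m]) (quadPerm 1 (Fin.castAdd 4 r))) *
      S.riem (fun r => (Fin.append ![a, b, c, d] ![e, f, l, m]) (quadPerm 1 (Fin.natAdd 4 r))) =
      S.lower e a m b * S.lower f l c d := rfl
  have h2 (e f l m : ι) :
      S.riem (fun r => (Fin.append ![a, b, c, d] ![e, f, l, m]) (quadPerm 2 (Fin.castAdd 4 r))) *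
      S.riem (fun r => (Fin.append ![a, b, c, d] ![e, f, l, m]) (quadPerm 2 (Fin.natAdd 4 r))) =
      S.lower e a m c * S.lower f b l d := rfl
  have h3 (e f l m : ι) :
      S.riem (fun r => (Fin.append ![a, b, c, d] ![e, f, l, m]) (quadPerm 3 (Fin.castAdd 4 r))) *
      S.riem (fun r => (Fin.append ![a, b, c, d] ![e, f, l, m]) (quadPerm 3 (Fin.natAdd 4 r))) =
      S.lower e a m d * S.lower f b c l := rfl
  have ha (e f : ι) : act (S.curv e a) S.riem ![f, b, c, d] =
      ∑ l, (S.curv e a l f * S.lower l b c d + S.curv e a l b * S.lower f l c d +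
        S.curv e a l c * S.lower f b l d + S.curv e a l d * S.lower f b c l) := by
    have h0 (l : ι) : Function.update ![f, b, c, d] 0 l = ![l, b, c, d] := by
      ext i; fin_cases i <;> rfl
    have h1 (l : ι) : Function.update ![f, b, c, d] 1 l = ![f, l, c, d] := by
      ext i; fin_cases i <;> rfl
    have h2 (l : ι) : Function.update ![f, b, c, d] 2 l = ![f, b, l, d] := by
      ext i; fin_cases i <;> rfl
    have h3 (l : ι) : Function.update ![f, b, c, d] 3 l = ![f, b, c, l] := by
      ext i; fin_cases i <;> rfl
    simp only [Finset.sum_add_distrib]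
    rw [act, Fin.sum_univ_four]
    simp only [h0, h1, h2, h3]
    rfl
  rw [Fin.sum_univ_four]
  simp only [contrSq, sum_fin_four, h0, h1, h2, h3, Matrix.cons_val, ← Finset.sum_add_distrib]
  rw [quad]
  refine Finset.sum_congr rfl fun e _ => Finset.sum_congr rfl fun f _ => ?_
  rw [ha, Finset.mul_sum]
  refine Finset.sum_congr rfl fun l _ => ?_
  simp only [hc, Finset.sum_mul, ← Finset.sum_add_distrib, Finset.mul_sum]
  exact Finset.sum_congr rfl fun m _ => by ring

theorem contrSq_swap (σ : Equiv.Perm (Fin (4 + 4))) (a b c d : ι) :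
    S.contrSq σ ![b, a, c, d] = S.contrSq (σ.trans (Equiv.swap 0 1)) ![a, b, c, d] := by
  have h (J : Fin 4 → ι) : (Fin.append ![b, a, c, d] J : Fin (4 + 4) → ι) =
      Fin.append ![a, b, c, d] J ∘ (Equiv.swap 0 1 : Equiv.Perm (Fin (4 + 4))) := by
    funext i; fin_cases i <;> rfl
  simp only [contrSq, h, Function.comp_apply, Equiv.trans_apply]

/-- The coefficients of the quadratic terms in the Laplacian of the curvature. -/
def lapCoeff (σ : Equiv.Perm (Fin (4 + 4))) : ℝ :=
  -- Signed multiplicities in `quad b a c d - quad a b c d`; the transposition exchanges `a` and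
  -- `b`.
  ∑ i, ((if (quadPerm i).trans (Equiv.swap 0 1) = σ then 1 else 0) -
    if quadPerm i = σ then 1 else 0)

theorem sum_lapCoeff_mul (F : Equiv.Perm (Fin (4 + 4)) → ℝ) :
    ∑ σ, lapCoeff σ * F σ =
      ∑ i, F ((quadPerm i).trans (Equiv.swap 0 1)) - ∑ i, F (quadPerm i) := by
  simp only [lapCoeff, Finset.sum_mul, sub_mul, ite_mul, one_mul, zero_mul]
  rw [Finset.sum_comm]
  simp only [Finset.sum_sub_distrib, Finset.sum_ite_eq, Finset.mem_univ, if_true]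

end Quadratic

/-! ### Christoffel symbols of a metric over a real algebra. -/

section OfMetric

variable {A ι : Type*} [CommRing A] [Algebra ℝ A] [Fintype ι] [DecidableEq ι]

/-- The Levi-Civita connection of a metric. -/
def ofMetric (D : ι → Derivation ℤ A A) (hD : ∀ i j a, D i (D j a) = D j (D i a))
    (g u : Matrix ι ι A) (hg : g.transpose = g) (hu : g * u = 1) : MetricConnection A ι where
  D := D
  D_comm := hD
  g := g
  u := u
  Γ a := u * Matrix.of fun d b => (1 / 2 : ℝ) • (D a (g b d) + D b (g a d) - D d (g a b))
  g_symm := hg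
  g_mul_u := hu
  torsion_free a b c := by
    have hg' (i j : ι) : g i j = g j i := congrFun (congrFun hg j) i
    simp only [Matrix.mul_apply, Matrix.of_apply, hg' a b, add_comm (D a _)]
  metric a := by
    have hg' (i j : ι) : g i j = g j i := congrFun (congrFun hg j) i
    set K : Matrix ι ι A :=
      Matrix.of fun d b => (1 / 2 : ℝ) • (D a (g b d) + D b (g a d) - D d (g a b)) with hK
    -- With lowered index, compatibility reads `∂_a g = Kᵀ + K`, where the unwanted derivatives
    -- cancel.
    have h1 : g * (u * K) = K := by rw [← mul_assoc, hu, one_mul]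
    have h2 : (u * K).transpose * g = K.transpose := by
      conv_lhs => rw [← hg]
      rw [← Matrix.transpose_mul, h1]
    rw [h1, h2]
    ext i j
    simp only [hK, Matrix.map_apply, Matrix.add_apply, Matrix.transpose_apply, Matrix.of_apply]
    rw [hg' j i]
    module

end OfMetric

end MetricConnection

/-! ### The ring of smooth functions on an open set, and comparison with coordinate formulas. -/

namespace LocalTensor

open TopologicalSpace

variable {m : ℕ} {U : Opens (Coord m)}

theorem pd_congr {F G : Coord m → ℝ} (h : ∀ y ∈ U, F y = G y) (i : Fin m) {y : Coord m}
    (hy : y ∈ U) : pd i F y = pd i G y := by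
  have : F =ᶠ[nhds y] G := Filter.eventually_of_mem (U.isOpen.mem_nhds hy) h
  rw [pd, pd, this.fderiv_eq]

theorem contDiffOn_pd {F : Coord m → ℝ} (hF : ContDiffOn ℝ ∞ F U) (i : Fin m) :
    ContDiffOn ℝ ∞ (pd i F) U :=
  (hF.fderiv_of_isOpen U.isOpen (by simp)).clm_apply contDiffOn_const

theorem pd_comm {F : Coord m → ℝ} (hF : ContDiffOn ℝ ∞ F U) (i j : Fin m) {y : Coord m}
    (hy : y ∈ U) : pd i (pd j F) y = pd j (pd i F) y := by
  have hF' : ContDiffAt ℝ ∞ F y := hF.contDiffAt (U.isOpen.mem_nhds hy)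
  have hd : DifferentiableAt ℝ (fderiv ℝ F) y :=
    (hF'.fderiv_right (m := ∞) (by simp)).differentiableAt (by simp)
  have h (i j : Fin m) : pd i (pd j F) y =
      fderiv ℝ (fderiv ℝ F) y (EuclideanSpace.single i 1) (EuclideanSpace.single j 1) := by
    have : pd j F = fun z => fderiv ℝ F z (EuclideanSpace.single j 1) := rfl
    rw [this, pd, fderiv_clm_apply hd (differentiableAt_const _)]
    simp
  rw [h, h]
  exact hF'.isSymmSndFDerivAt (by simpa using WithTop.coe_le_coe.2 (le_top : (2 : ℕ∞) ≤ ⊤)) _ _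

variable (U) in
/-- The algebra of smooth functions on an open set. -/
def smoothFun : Subalgebra ℝ (U → ℝ) where
  -- Elements are functions on `U` alone, so values outside `U` do not matter; the witness `F` is
  -- there to be differentiated.
  carrier := {a | ∃ F : Coord m → ℝ, ContDiffOn ℝ ∞ F U ∧ ∀ y : U, F y = a y}
  mul_mem' := by
    rintro a b ⟨F, hF, hFa⟩ ⟨G, hG, hGb⟩
    exact ⟨fun y => F y * G y, hF.mul hG, fun y => by simp [hFa, hGb]⟩
  add_mem' := by
    rintro a b ⟨F, hF, hFa⟩ ⟨G, hG, hGb⟩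
    exact ⟨fun y => F y + G y, hF.add hG, fun y => by simp [hFa, hGb]⟩
  algebraMap_mem' r := ⟨fun _ => r, contDiffOn_const, fun _ => rfl⟩

instance : IsAddTorsionFree (smoothFun U) where
  nsmul_right_injective n hn a b h := by
    ext y
    have := congrFun (congrArg Subtype.val h) y
    simpa [hn] using this

/-- Evaluation at a point. -/
def evalAt (y : U) : smoothFun U →+* ℝ := (Pi.evalRingHom (fun _ => ℝ) y).comp (smoothFun U).val

theorem evalAt_smul (y : U) (r : ℝ) (a : smoothFun U) : evalAt y (r • a) = r * evalAt y a := rfl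

theorem smoothFun_ext {a b : smoothFun U} (h : ∀ y, evalAt y a = evalAt y b) : a = b :=
  Subtype.ext (funext h)

/-- The element `a` is the restriction of the function `F`. -/
def Restr (F : Coord m → ℝ) (a : smoothFun U) : Prop := ∀ y : U, evalAt y a = F y

namespace Restr

variable {F G : Coord m → ℝ} {a b : smoothFun U}

theorem contDiffOn (h : Restr F a) : ContDiffOn ℝ ∞ F U := by
  obtain ⟨F', hF', hF'a⟩ := a.2
  exact hF'.congr fun y hy => (h ⟨y, hy⟩).symm.trans (hF'a ⟨y, hy⟩).symm

theorem add (h : Restr F a) (h' : Restr G b) : Restr (fun y => F y + G y) (a + b) :=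
  fun y => by rw [map_add, h, h']

theorem sub (h : Restr F a) (h' : Restr G b) : Restr (fun y => F y - G y) (a - b) :=
  fun y => by rw [map_sub, h, h']

theorem mul (h : Restr F a) (h' : Restr G b) : Restr (fun y => F y * G y) (a * b) :=
  fun y => by rw [map_mul, h, h']

theorem const_mul (h : Restr F a) (r : ℝ) : Restr (fun y => r * F y) (r • a) :=
  fun y => by rw [evalAt_smul, h]

theorem sum {α : Type*} {t : Finset α} {F : α → Coord m → ℝ} {a : α → smoothFun U}
    (h : ∀ i, Restr (F i) (a i)) : Restr (fun y => ∑ i ∈ t, F i y) (∑ i ∈ t, a i) :=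
  fun y => by rw [map_sum]; exact Finset.sum_congr rfl fun i _ => h i y

theorem differentiableAt (h : Restr F a) (y : U) : DifferentiableAt ℝ F y :=
  (h.contDiffOn.contDiffAt (U.isOpen.mem_nhds y.2)).differentiableAt (by simp)

end Restr

/-- The restriction of a smooth function. -/
def restr (F : Coord m → ℝ) (hF : ContDiffOn ℝ ∞ F U) : smoothFun U :=
  ⟨fun y => F y, F, hF, fun _ => rfl⟩

theorem restr_spec (F : Coord m → ℝ) (hF : ContDiffOn ℝ ∞ F U) : Restr F (restr F hF) :=
  fun _ => rfl

/-- An extension of a smooth function to the whole space. -/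
def extend (a : smoothFun U) : Coord m → ℝ := a.2.choose

theorem extend_spec (a : smoothFun U) : Restr (extend a) a :=
  fun y => (a.2.choose_spec.2 y).symm

/-- Derivatives at points of the open set `U` do not depend on the chosen extension. -/
theorem Restr.pd_eq {F : Coord m → ℝ} {a : smoothFun U} (h : Restr F a) (i : Fin m) (y : U) :
    pd i (extend a) y = pd i F y :=
  pd_congr (fun z hz => (extend_spec a ⟨z, hz⟩).symm.trans (h ⟨z, hz⟩)) i y.2

/-- The partial derivatives, as derivations of the algebra of smooth functions. -/
def pdDeriv (i : Fin m) : Derivation ℤ (smoothFun U) (smoothFun U) :=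
  Derivation.mk' (AddMonoidHom.toIntLinearMap <| AddMonoidHom.mk'
    (fun a => restr (pd i (extend a)) (contDiffOn_pd (extend_spec a).contDiffOn i))
    fun a b => by
      refine smoothFun_ext fun y => ?_
      have ha := extend_spec a
      have hb := extend_spec b
      change pd i (extend (a + b)) y = pd i (extend a) y + pd i (extend b) y
      rw [(ha.add hb).pd_eq, pd, fderiv_fun_add (ha.differentiableAt y) (hb.differentiableAt y)]
      rfl)
    fun a b => by
      refine smoothFun_ext fun y => ?_
      have ha := extend_spec a
      have hb := extend_spec b
      change pd i (extend (a * b)) y =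
        evalAt y a * pd i (extend b) y + evalAt y b * pd i (extend a) y
      rw [(ha.mul hb).pd_eq, pd, fderiv_fun_mul (ha.differentiableAt y) (hb.differentiableAt y),
        ha y, hb y]
      rfl

theorem Restr.pd {F : Coord m → ℝ} {a : smoothFun U} (h : Restr F a) (i : Fin m) :
    Restr (LocalTensor.pd i F) (pdDeriv i a) :=
  fun y => h.pd_eq i y

theorem pdDeriv_comm (i j : Fin m) (a : smoothFun U) :
    pdDeriv i (pdDeriv j a) = pdDeriv j (pdDeriv i a) := by
  refine smoothFun_ext fun y => ?_
  have ha := extend_spec a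
  rw [(ha.pd j).pd i y, (ha.pd i).pd j y, pd_comm ha.contDiffOn i j y.2]

theorem isUnit_of_evalAt_ne_zero {a : smoothFun U} (h : ∀ y, evalAt y a ≠ 0) : IsUnit a := by
  have ha := extend_spec a
  refine IsUnit.of_mul_eq_one (restr (fun y => (extend a y)⁻¹) (ha.contDiffOn.inv fun y hy => ?_)) ?_
  · rw [← ha ⟨y, hy⟩]; exact h _
  · refine smoothFun_ext fun y => ?_
    rw [map_mul, restr_spec, map_one, ← ha y, mul_inv_cancel₀ (h y)]

/-! ### The Levi-Civita connection of a metric on an open set -/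

/-- A smooth pseudo-Riemannian metric on an open set, in components. -/
structure IsMetricOn (g : Coord m → Matrix (Fin m) (Fin m) ℝ) (U : Opens (Coord m)) : Prop where
  smooth : ∀ i j, ContDiffOn ℝ ∞ (fun y => g y i j) U
  symm : ∀ y ∈ U, ∀ i j, g y i j = g y j i
  det_ne_zero : ∀ y ∈ U, (g y).det ≠ 0

namespace IsMetricOn

variable {g : Coord m → Matrix (Fin m) (Fin m) ℝ} (hg : IsMetricOn g U)

/-- The matrix of restrictions of the components of the metric. -/
def mat : Matrix (Fin m) (Fin m) (smoothFun U) := Matrix.of fun i j => restr _ (hg.smooth i j)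

theorem isUnit_det : IsUnit hg.mat.det :=
  isUnit_of_evalAt_ne_zero fun y => by
    rw [RingHom.map_det]
    exact hg.det_ne_zero y y.2

/-- The Levi-Civita connection over the algebra of smooth functions. -/
def conn : MetricConnection (smoothFun U) (Fin m) :=
  .ofMetric pdDeriv pdDeriv_comm hg.mat hg.mat⁻¹
    (by ext i j y; exact hg.symm y y.2 j i) (Matrix.mul_nonsing_inv _ hg.isUnit_det)

theorem restr_g (i j : Fin m) : Restr (fun y => g y i j) (hg.conn.g i j) := fun _ => rfl

theorem restr_u (i j : Fin m) : Restr (fun y => up g y i j) (hg.conn.u i j) := fun y => by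
  have h := congrArg (fun M : Matrix (Fin m) (Fin m) (smoothFun U) => M.map (evalAt y))
    hg.conn.g_mul_u
  have h1 : (1 : Matrix (Fin m) (Fin m) (smoothFun U)).map (evalAt y) = 1 :=
    Matrix.map_one _ (map_zero _) (map_one _)
  simp only [Matrix.map_mul, h1] at h
  -- The pointwise inverse and the inverse over the ring agree by uniqueness of right inverses.
  have h2 : (g y)⁻¹ = hg.conn.u.map (evalAt y) := Matrix.inv_eq_right_inv h
  exact (congrFun (congrFun h2 i) j).symm

theorem restr_Γ (a b c : Fin m) :
    Restr (fun y => christoffel g y c a b) (hg.conn.Γ a c b) := by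
  have h := (Restr.sum (t := Finset.univ) fun d => (hg.restr_u c d).mul
    ((((hg.restr_g b d).pd a).add ((hg.restr_g a d).pd b)).sub ((hg.restr_g a b).pd d))).const_mul
      (1 / 2)
  have e : hg.conn.Γ a c b = (1 / 2 : ℝ) • ∑ d, hg.conn.u c d * (pdDeriv a (hg.conn.g b d) +
      pdDeriv b (hg.conn.g a d) - pdDeriv d (hg.conn.g a b)) := by
    simp only [Finset.smul_sum, ← mul_smul_comm]
    rfl
  rw [e]
  exact h

theorem restr_curv (a b c d : Fin m) :
    Restr (fun y => curv g y a b c d) (hg.conn.curv a b c d) := by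
  have h := (((hg.restr_Γ b d c).pd a).sub ((hg.restr_Γ a d c).pd b)).add
    (Restr.sum (t := Finset.univ) fun l => ((hg.restr_Γ a l c).mul (hg.restr_Γ b d l)).sub
      ((hg.restr_Γ b l c).mul (hg.restr_Γ a d l)))
  have e : hg.conn.curv a b c d = pdDeriv a (hg.conn.Γ b c d) - pdDeriv b (hg.conn.Γ a c d) +
      ∑ l, (hg.conn.Γ a c l * hg.conn.Γ b l d - hg.conn.Γ b c l * hg.conn.Γ a l d) := by
    rw [Finset.sum_sub_distrib]
    rfl
  rw [e]
  exact h

theorem restr_riem (I : Fin 4 → Fin m) : Restr (fun y => riem g y I) (hg.conn.riem I) :=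
  Restr.sum fun e => (hg.restr_g (I 2) e).mul (hg.restr_curv (I 0) (I 1) e (I 3))

theorem restr_ric (I : Fin 2 → Fin m) : Restr (fun y => ric g y I) (hg.conn.ric I) :=
  Restr.sum fun c => hg.restr_curv c (I 0) c (I 1)

variable {k : ℕ} {T : Comp m k} {t : MetricConnection.Tens (smoothFun U) (Fin m) k}

theorem restr_cov (h : ∀ I, Restr (fun y => T y I) (t I)) (I : Fin (k + 1) → Fin m) :
    Restr (fun y => cov g T y I) (hg.conn.cov t I) :=
  ((h (Fin.tail I)).pd (I 0)).sub (Restr.sum fun r => Restr.sum fun l =>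
    (hg.restr_Γ (I 0) (Fin.tail I r) l).mul (h _))

theorem restr_laplacian (h : ∀ I, Restr (fun y => T y I) (t I)) (I : Fin k → Fin m) :
    Restr (fun y => laplacian g T y I) (hg.conn.lap t I) :=
  Restr.sum fun e => Restr.sum fun f => (hg.restr_u e f).mul (hg.restr_cov (hg.restr_cov h) _)

theorem restr_skewCovRic (I : Fin 3 → Fin m) :
    Restr (fun y => skewCovRic g y I) ((1 / 2 : ℝ) • hg.conn.skew I) :=
  ((hg.restr_cov hg.restr_ric ![I 0, I 1, I 2]).sub
    (hg.restr_cov hg.restr_ric ![I 1, I 0, I 2])).const_mul _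

theorem evalAt_skew (y : U) (I : Fin 3 → Fin m) :
    evalAt y (hg.conn.skew I) = 2 * skewCovRic g y I := by
  have h := hg.restr_skewCovRic I y
  rw [evalAt_smul] at h
  linarith

theorem evalAt_nab_skew (y : U) (a : Fin m) (I : Fin 3 → Fin m) :
    evalAt y (hg.conn.nab a hg.conn.skew I) = 2 * cov g (skewCovRic g) y (Fin.cons a I) := by
  have h := hg.restr_cov hg.restr_skewCovRic (Fin.cons a I) y
  -- `skew` lacks the factor `1 / 2` of `skewCovRic`. Splitting it into two halves needs only
  -- additivity of `nab`.
  have h2 : hg.conn.skew = (fun I => (1 / 2 : ℝ) • hg.conn.skew I) +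
      fun I => (1 / 2 : ℝ) • hg.conn.skew I := by
    funext I
    rw [Pi.add_apply]
    module
  rw [h2, MetricConnection.nab_add, Pi.add_apply, map_add, two_mul]
  exact congrArg₂ (· + ·) h h

theorem restr_contractRR (σ : Equiv.Perm (Fin (4 + 4))) (I : Fin 4 → Fin m) :
    Restr (fun y => contractRR g σ y I) (hg.conn.contrSq σ I) :=
  Restr.sum fun _ => ((hg.restr_u _ _).mul (hg.restr_u _ _)).mul
    ((hg.restr_riem _).mul (hg.restr_riem _))

include hg

theorem div_riem {y : Coord m} (hy : y ∈ U) (a b c : Fin m) :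
    ∑ e, ∑ f, up g y e f * cov g (riem g) y ![f, e, a, b, c] = 2 * skewCovRic g y ![b, c, a] := by
  have h := congrArg (evalAt ⟨y, hy⟩) (hg.conn.div_riem a b c)
  rw [evalAt_skew] at h
  rw [← h]
  simp only [map_sum, map_mul, hg.restr_u _ _ _]
  exact Finset.sum_congr rfl fun e _ => Finset.sum_congr rfl fun f _ =>
    congrArg _ (hg.restr_cov hg.restr_riem _ ⟨y, hy⟩).symm

theorem laplacian_riem {y : Coord m} (hy : y ∈ U) (a b c d : Fin m) :
    laplacian g (riem g) y ![a, b, c, d] =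
      2 * (cov g (skewCovRic g) y ![a, c, d, b] - cov g (skewCovRic g) y ![b, c, d, a]) +
        ∑ σ, MetricConnection.lapCoeff σ * contractRR g σ y ![a, b, c, d] := by
  have h := congrArg (evalAt ⟨y, hy⟩) (hg.conn.lap_riem a b c d)
  rw [hg.restr_laplacian hg.restr_riem, MetricConnection.quad_eq_sum,
    MetricConnection.quad_eq_sum] at h
  simp only [MetricConnection.contrSq_swap _ _ a b, map_add, map_sub, map_sum, evalAt_nab_skew,
    hg.restr_contractRR _ _ _] at h
  rw [MetricConnection.sum_lapCoeff_mul, h, mul_sub]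
  rfl

theorem laplacian_cov {T : Comp m k} (hT : ∀ I, ContDiffOn ℝ ∞ (fun y => T y I) U)
    {y : Coord m} (hy : y ∈ U) (c : Fin m) (I : Fin k → Fin m) :
    laplacian g (cov g T) y (Fin.cons c I) - cov g (laplacian g T) y (Fin.cons c I) =
      -2 * (∑ r : Fin k, ∑ e, ∑ f, up g y e f *
        (T y (Function.update I r e) * skewCovRic g y ![f, I r, c])) -
      2 * (∑ r : Fin k, ∑ e, ∑ e', ∑ f, up g y e e' *
        (curv g y e c f (I r) * cov g T y (Fin.cons e' (Function.update I r f)))) +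
      ∑ e, ∑ e', up g y e e' * (ric g y ![c, e] * cov g T y (Fin.cons e' I)) := by
  have ht (I : Fin k → Fin m) := restr_spec _ (hT I)
  have h := congrArg (evalAt ⟨y, hy⟩) (hg.conn.lap_cov_sub (fun I => restr _ (hT I)) c I)
  simp only [map_add, map_sub, map_neg, map_sum, map_mul, map_ofNat, evalAt_skew,
    hg.restr_u _ _ _, hg.restr_curv _ _ _ _ _, hg.restr_ric _ _, hg.restr_cov ht _ _,
    hg.restr_laplacian (hg.restr_cov ht) _ _, hg.restr_cov (hg.restr_laplacian ht) _ _,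
    restr_spec _ (hT _) _] at h
  rw [h]
  congr 2
  simp only [Finset.mul_sum, neg_mul, ← Finset.sum_neg_distrib]
  exact Finset.sum_congr rfl fun r _ => Finset.sum_congr rfl fun e _ =>
    Finset.sum_congr rfl fun f _ => by ring

end IsMetricOn

end LocalTensor

/-! ### From signature and charts to a metric on an open set of coordinate space. -/

theorem HasSignature.isSymm {V : Type*} [AddCommGroup V] [Module ℝ V] {p q : ℕ}
    {B : LinearMap.BilinForm ℝ V} (hB : HasSignature p q B) (v w : V) : B v w = B w v := by
  obtain ⟨b, hb⟩ := hB
  have h : B = LinearMap.flip B := by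
    refine b.ext fun i => b.ext fun j => ?_
    rw [LinearMap.flip_apply, hb, hb, Matrix.diagonal_apply, Matrix.diagonal_apply]
    by_cases hij : i = j
    · simp [hij]
    · simp [hij, Ne.symm hij]
  exact congrArg (fun C : LinearMap.BilinForm ℝ V => C v w) h

theorem HasSignature.nondegenerate {V : Type*} [AddCommGroup V] [Module ℝ V] {p q : ℕ}
    {B : LinearMap.BilinForm ℝ V} (hB : HasSignature p q B) : B.Nondegenerate := by
  obtain ⟨b, hb⟩ := hB
  have h : LinearMap.BilinForm.toMatrix b B =
      Matrix.diagonal (Sum.elim (fun _ => (1 : ℝ)) (fun _ => (-1 : ℝ))) := by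
    ext i j
    rw [LinearMap.BilinForm.toMatrix_apply, hb]
  refine LinearMap.BilinForm.nondegenerate_of_det_ne_zero B b ?_
  rw [h, Matrix.det_diagonal]
  refine Finset.prod_ne_zero_iff.2 fun i _ => ?_
  rcases i with i | i <;> simp

section Manifold

variable {m : ℕ} {N : Type*} [TopologicalSpace N] [ChartedSpace (EuclideanSpace ℝ (Fin m)) N]

/-- The coordinate vector fields of a smooth chart are a basis of each tangent space. -/
theorem exists_basis_coordVec {e : OpenPartialHomeomorph N (EuclideanSpace ℝ (Fin m))}
    (he : e ∈ IsManifold.maximalAtlas (𝓡 m) ∞ N) {y : EuclideanSpace ℝ (Fin m)}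
    (hy : y ∈ e.target) :
    ∃ b : Module.Basis (Fin m) ℝ (TangentSpace (𝓡 m) (e.symm y)), ∀ i, b i = coordVec e y i := by
  have h : e.symm.MDifferentiable (𝓡 m) (𝓡 m) :=
    ⟨(contMDiffOn_symm_of_mem_maximalAtlas he).mdifferentiableOn (by simp),
      (contMDiffOn_of_mem_maximalAtlas he).mdifferentiableOn (by simp)⟩
  let L : EuclideanSpace ℝ (Fin m) ≃ₗ[ℝ] TangentSpace (𝓡 m) (e.symm y) :=
    (h.mfderiv hy).toLinearEquiv
  refine ⟨(EuclideanSpace.basisFun (Fin m) ℝ).toBasis.map L, fun i => ?_⟩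
  rw [Module.Basis.map_apply, OrthonormalBasis.coe_toBasis, EuclideanSpace.basisFun_apply]
  rfl

theorem PseudoRiemannianMetric.isMetricOn {p q : ℕ} (h : PseudoRiemannianMetric m p q N)
    {e : OpenPartialHomeomorph N (EuclideanSpace ℝ (Fin m))}
    (he : e ∈ IsManifold.maximalAtlas (𝓡 m) ∞ N) :
    IsMetricOn (bilinComp h.form e) ⟨e.target, e.open_target⟩ where
  smooth := h.smooth e he
  symm y _ i j := (h.signature (e.symm y)).isSymm _ _
  det_ne_zero y hy := by
    obtain ⟨b, hb⟩ := exists_basis_coordVec he hy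
    -- The component matrix is the Gram matrix in the basis of coordinate vectors, so nondegeneracy
    -- gives a nonzero determinant.
    have h' : bilinComp h.form e y = LinearMap.BilinForm.toMatrix b (h.form (e.symm y)) := by
      ext i j
      rw [LinearMap.BilinForm.toMatrix_apply, hb, hb]
      rfl
    rw [h']
    exact (LinearMap.BilinForm.nondegenerate_iff_det_ne_zero b).1 (h.signature _).nondegenerate

end Manifold
end

theorem proposition3p1 :
    -- universal coefficients of the linear combination of partial contractions in (2)
    ∃ coeff : Equiv.Perm (Fin (4 + 4)) → ℝ,
    ∀ (n p q : ℕ) (_ : 3 ≤ n) (_ : p + q = n)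
      (M : Type*) [TopologicalSpace M] [ChartedSpace (EuclideanSpace ℝ (Fin n)) M]
      [IsManifold (𝓡 n) ∞ M] (conf : ConformalStructure n p q M)
      (N : Type*) [TopologicalSpace N] [ChartedSpace (EuclideanSpace ℝ (Fin (n + 2))) N]
      [IsManifold (𝓡 (n + 2)) ∞ N] (amb : AmbientManifold conf N) (h : AmbientMetric amb),
      -- the tensor identities, in components with respect to every smooth chart `φ` of `N`
      ∀ φ ∈ IsManifold.maximalAtlas (𝓡 (n + 2)) ∞ N, ∀ y ∈ φ.target,
        -- (1)
        (∀ A B C : Fin (n + 2),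
          ∑ E, ∑ F, up (h.comp φ) y E F * cov (h.comp φ) (riem (h.comp φ)) y ![F, E, A, B, C] =
            2 * skewCovRic (h.comp φ) y ![B, C, A]) ∧
        -- (2)
        (∀ A B C D : Fin (n + 2),
          laplacian (h.comp φ) (riem (h.comp φ)) y ![A, B, C, D] =
            2 * (cov (h.comp φ) (skewCovRic (h.comp φ)) y ![A, C, D, B] -
                cov (h.comp φ) (skewCovRic (h.comp φ)) y ![B, C, D, A]) +
              ∑ σ, coeff σ * contractRR (h.comp φ) σ y ![A, B, C, D]) ∧
        -- (3), for covariant tensor fields of any rank `k`, with indices `I 0, …, I (k - 1)`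
        (∀ (k : ℕ) (Φ : CovTensorField (n + 2) k N), Φ.IsSmooth →
          ∀ (C : Fin (n + 2)) (I : Fin k → Fin (n + 2)),
            laplacian (h.comp φ) (cov (h.comp φ) (Φ.comp φ)) y (Fin.cons C I) -
                cov (h.comp φ) (laplacian (h.comp φ) (Φ.comp φ)) y (Fin.cons C I) =
              -2 * (∑ r : Fin k, ∑ E, ∑ F, up (h.comp φ) y E F *
                  (Φ.comp φ y (Function.update I r E) *
                    skewCovRic (h.comp φ) y ![F, I r, C])) -
                2 * (∑ r : Fin k, ∑ E, ∑ E', ∑ F, up (h.comp φ) y E E' *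
                  (curv (h.comp φ) y E C F (I r) *
                    cov (h.comp φ) (Φ.comp φ) y (Fin.cons E' (Function.update I r F)))) +
                ∑ E, ∑ E', up (h.comp φ) y E E' *
                  (ric (h.comp φ) y ![C, E] * cov (h.comp φ) (Φ.comp φ) y (Fin.cons E' I))) := by
  refine ⟨MetricConnection.lapCoeff, ?_⟩
  intro n p q _ _ M _ _ _ conf N _ _ _ amb h φ hφ y hy
  have hg := h.toPseudoRiemannianMetric.isMetricOn hφ
  exact ⟨hg.div_riem hy, hg.laplacian_riem hy, fun k Φ hΦ => hg.laplacian_cov (hΦ φ hφ) hy⟩
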